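/- Let $G=(V,E)$ be a finite graph (parallel edges and loops allowed). Each edge consists of two half-edges; let $\mathcal{E}$ be the set of half-edges, $n=|\mathcal{E}|=2|E|$, and let $\mathcal{E}(v)$ be the set of half-edges at the vertex $v$. For every $v\in V$ let $f_v:\{0,1\}^{\mathcal{E}(v)}\to\mathbb{R}_{\ge 0}$ be windable. Here a function $F:\{0,1\}^J\to\mathbb{R}_{\ge0}$ ($J$ finite) is \emph{windable} if there are values $B(x,y,M)\ge 0$, for $x,y\in\{0,1\}^J$ and $M\in\mathcal{M}_{x\oplus y}$, such that $F(x)F(y)=\sum_{M\in\mathcal{M}_{x\oplus y}}B(x,y,M)$ for all $x,y$, and $B(x,y,M)=B(x\oplus S,y\oplus S,M)$ for all $x,y$ and all $S\in M\in\mathcal{M}_{x\oplus y}$, where $\mathcal{M}_z$ is the set of partitions of $\{i: z_i=1\}$ into pairs and at most one singleton, and $x\oplus S$ is $x$ with the entries in $S$ flipped. For $\sigma\in\{0,1\}^{\mathcal{E}}$ put $w(\sigma)=\prod_{v\in V}f_v(\sigma|_{\mathcal{E}(v)})$. Let $\Omega_k$ be the set of $\sigma\in\{0,1\}^{\mathcal{E}}$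 for which exactly $k$ edges have different values on their two half-edges, $Z_k=\sum_{\sigma\in\Omega_k}w(\sigma)$, $\Omega=\Omega_0\cup\Omega_2$, $\mu(\sigma)=w(\sigma)/(Z_0+Z_2)$ for $\sigma\in\Omega$, and $\mu(\Omega_0)=\sum_{\sigma\in\Omega_0}\mu(\sigma)$. With $d$ the Hamming distance, define for $\sigma,\pi\in\Omega$ \[ P'(\sigma,\pi)=\begin{cases}\frac{2}{n^2}\min\left(1,\frac{w(\pi)}{w(\sigma)}\right)&\text{if } d(\sigma,\pi)=2,\\ 1-\frac{2}{n^2}\sum_{\rho\in\Omega:\,d(\sigma,\rho)=2}\min\left(1,\frac{w(\rho)}{w(\sigma)}\right)&\text{if }\sigma=\pi,\\ 0&\text{otherwise}\end{cases} \] (configurations of weight $0$ are made absorbing), and let $P=\frac12(I+P')$ be its lazy version. Then $P$ is a stochastic matrix with $\mu P=\mu$, and for every $\sigma\in\Omega$ with $w(\sigma)>0$ and every integer $t\ge 0$, \[ \left\|P^t(\sigma,\cdot)-\mu\right\|_{TV}\le\frac12\,\mu(\sigma)^{-1/2}\exp\left(-t\cdot\mu(\Omega_0)^2/n^4\right), \]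 where $\|p-q\|_{TV}=\frac12\sum_{\pi\in\Omega}|p(\pi)-q(\pi)|$ (and the exponential is read as $1$ if $n=0$). -/

import Mathlib

open scoped Matrix

noncomputable section

namespace Holant

/-- Flip the values of `x` at the positions in `S`, written `x ⊕ S`. -/
def flip {J : Type*} [DecidableEq J] (x : J → Bool) (S : Finset J) : J → Bool :=
  fun i => if i ∈ S then !(x i) else x i

/-- The positions where `x` and `y` differ, i.e. the support of `x ⊕ y`. -/
def diff {J : Type*} [Fintype J] (x y : J → Bool) : Finset J :=
  {i | x i ≠ y i}

/-- `M` is a partition of the finite set `A` into pairs and at most one singleton. -/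
def IsPairing {J : Type*} [DecidableEq J] (A : Finset J) (M : Finset (Finset J)) : Prop :=
  (M : Set (Finset J)).PairwiseDisjoint id ∧ M.biUnion id = A ∧
    (∀ S ∈ M, S.card = 1 ∨ S.card = 2) ∧ (M.filter fun S => S.card = 1).card ≤ 1

open Classical in
/-- The set of all partitions of `A` into pairs and at most one singleton. -/
def pairings {J : Type*} [Fintype J] [DecidableEq J] (A : Finset J) :
    Finset (Finset (Finset J)) :=
  {M | IsPairing A M}

/-- Windability of a nonnegative function on `{0,1}^J`: `F x * F y` splits as a sum of nonnegative
values `B x y M` over the pairings `M` of `x ⊕ y`, which are invariant under flipping a block of `M`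
in both `x` and `y`. -/
def Windable {J : Type*} [Fintype J] [DecidableEq J] (F : (J → Bool) → ℝ) : Prop :=
  ∃ B : (J → Bool) → (J → Bool) → Finset (Finset J) → ℝ,
    (∀ x y, ∀ M ∈ pairings (diff x y), 0 ≤ B x y M) ∧
    (∀ x y, F x * F y = ∑ M ∈ pairings (diff x y), B x y M) ∧
    (∀ x y, ∀ M ∈ pairings (diff x y), ∀ S ∈ M, B x y M = B (flip x S) (flip y S) M)

/-- A Holant instance on a graph with vertices `V` and edges `E` (parallel edges and loops are
allowed). The edge `e` has the two half-edges `(e, false)` and `(e, true)`; the half-edge `(e, b)`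
sits at the vertex `endpoint (e, b)`. The constraint at `v` is a nonnegative function of the values
of the half-edges at `v`. -/
structure Instance (V E : Type*) where
  endpoint : E × Bool → V
  f : (v : V) → ({h : E × Bool // endpoint h = v} → Bool) → ℝ
  f_nonneg : ∀ v x, 0 ≤ f v x

/-- Assignments of bits to the half-edges. -/
abbrev Config (E : Type*) := E × Bool → Bool

/-- The number of edges whose two half-edges carry different values. -/
def disagreements {E : Type*} [Fintype E] (σ : Config E) : ℕ :=
  (Finset.univ.filter fun e : E => σ (e, false) ≠ σ (e, true)).card

/-- The state space `Ω = Ω₀ ∪ Ω₂`, where `Ω_k` consists of the configurations with exactly `k`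
disagreeing edges. -/
abbrev State (E : Type*) [Fintype E] :=
  {σ : Config E // disagreements σ = 0 ∨ disagreements σ = 2}

/-- The number `n` of half-edges. -/
def numHalfEdges (E : Type*) [Fintype E] : ℕ := Fintype.card (E × Bool)

namespace Instance

variable {V E : Type*} [Fintype V] [Fintype E] [DecidableEq E] (Λ : Instance V E)

/-- The weight `w(σ) = ∏_v f_v(σ restricted to the half-edges at v)`. -/
def weight (σ : Config E) : ℝ := ∏ v, Λ.f v fun h => σ h.1

/-- `Z k` is the total weight of `Ω_k`. -/
def Z (k : ℕ) : ℝ := ∑ σ : Config E with disagreements σ = k, Λ.weight σ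

/-- The distribution `μ(σ) = w(σ) / (Z₀ + Z₂)` on `Ω`. -/
def μ (σ : State E) : ℝ := Λ.weight σ.1 / (Λ.Z 0 + Λ.Z 2)

/-- `μ(Ω₀)`. -/
def μΩ₀ : ℝ := ∑ σ : State E with disagreements σ.1 = 0, Λ.μ σ

/-- The Metropolis chain `P'` on `Ω` that flips two half-edges.
(A configuration of weight `0` is absorbing: the quotients are then `0`.) -/
def metropolis : Matrix (State E) (State E) ℝ := fun σ π =>
  if hammingDist σ.1 π.1 = 2 then
    2 / (numHalfEdges E : ℝ) ^ 2 * min 1 (Λ.weight π.1 / Λ.weight σ.1)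
  else if σ = π then
    1 - 2 / (numHalfEdges E : ℝ) ^ 2 *
      ∑ ρ : State E with hammingDist σ.1 ρ.1 = 2, min 1 (Λ.weight ρ.1 / Λ.weight σ.1)
  else 0

/-- The lazy version `P` of `P'`. -/
def lazyChain : Matrix (State E) (State E) ℝ := fun σ π =>
  if σ = π then (1 + Λ.metropolis σ π) / 2 else Λ.metropolis σ π / 2

end Instance

/-- Total variation distance between two functions on a finite set. -/
def tvDist {α : Type*} [Fintype α] (p q : α → ℝ) : ℝ := (1 / 2) * ∑ a, |p a - q a|

end Holant

end

/-! The spectral gap is bounded by a multicommodity flow from Ω₀ to Ω. For x, y at even distance,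
windability of all f_v splits w(x)w(y) into parts b(x, M) ≥ 0 over perfect matchings M of x ⊕ y: the
pairings at the vertices are put together and their leftover singletons are paired arbitrarily
(`exists_isWinding`). Flipping x along blocks of M leaves b(x, M) unchanged.

For z ∈ Ω₀ and y ∈ Ω, the blocks of M can be flipped one by one without leaving Ω, and b(z, M) units
of flow take this path. At a configuration a on the path, the complementary configuration, a flipped
on all of M, has at most four disagreeing edges. Since b(z, M) = b(a, M), the move from a to a ⊕ S
carries at most min(w(a), w(a ⊕ S)) · (Z₀ + Z₂ + Z₄) (`sum_le_min_mul_sum`, `sum_sq_sub_le`).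
Cutting matchings with four split edges in two gives Z₀Z₄ ≤ Z₂² (`sum_zero_mul_sum_four_le`), whence
Z₀(Z₀ + Z₂ + Z₄) ≤ (Z₀ + Z₂)².

As paths have at most n/2 moves, a Poincaré inequality follows (`Z_sq_mul_sum_le`, `poincare`). One
factor μ(Ω₀) pays for Z₄, the other for the flow starting in Ω₀ only. Laziness makes the chain
positive semidefinite, so the Poincaré inequality yields L² contraction, and Cauchy–Schwarz passes
to total variation (`tvDist_pow_le`). -/

namespace Holant

open Finset

/-! ### Flips of configurations -/

section Flip

variable {J : Type*} [DecidableEq J]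

lemma flip_flip (x : J → Bool) (S T : Finset J) : flip (flip x S) T = flip x (symmDiff S T) := by
  funext i
  by_cases h1 : i ∈ S <;> by_cases h2 : i ∈ T <;> simp [flip, mem_symmDiff, h1, h2]

lemma flip_empty (x : J → Bool) : flip x ∅ = x := by
  funext i; simp [flip]

lemma flip_flip_self (x : J → Bool) (S : Finset J) : flip (flip x S) S = x := by
  rw [flip_flip, symmDiff_self]; exact flip_empty x

lemma flip_injective (S : Finset J) : Function.Injective (fun x : J → Bool => flip x S) :=
  Function.LeftInverse.injective (g := fun x => flip x S) fun x => flip_flip_self x S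

variable [Fintype J]

lemma diff_flip (x : J → Bool) (S : Finset J) : diff x (flip x S) = S := by
  ext i
  by_cases h : i ∈ S <;> simp [diff, flip, h]

lemma flip_diff (x y : J → Bool) : flip x (diff x y) = y := by
  funext i
  by_cases h : x i = y i
  · simp [diff, flip, h]
  · simp only [diff, flip, mem_filter, mem_univ, true_and, ne_eq, h, not_false_eq_true, if_true]
    revert h; cases x i <;> cases y i <;> simp

/-- Flipping a fixed configuration identifies sets of positions with configurations. -/
def flipEquiv (x : J → Bool) : Finset J ≃ (J → Bool) where
  toFun := flip x
  invFun := diff x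
  left_inv := diff_flip x
  right_inv := flip_diff x

lemma hammingDist_flip (x : J → Bool) (S : Finset J) : hammingDist x (flip x S) = S.card := by
  conv_rhs => rw [← diff_flip x S]
  rfl

end Flip

/-! ### Split edges and their parity -/

section SplitEdges

variable {E : Type*} [Fintype E] [DecidableEq E]

/-- The edges with exactly one half-edge in `T`. -/
def splitEdges (T : Finset (E × Bool)) : Finset E :=
  {e | ¬((e, false) ∈ T ↔ (e, true) ∈ T)}

lemma splitEdges_symmDiff (S T : Finset (E × Bool)) :
    splitEdges (symmDiff S T) = symmDiff (splitEdges S) (splitEdges T) := by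
  ext e
  simp only [splitEdges, mem_filter, mem_univ, true_and, mem_symmDiff]
  tauto

lemma splitEdges_empty : splitEdges (∅ : Finset (E × Bool)) = ∅ := by
  simp [splitEdges]

lemma card_symmDiff_add {α : Type*} [DecidableEq α] (A B : Finset α) :
    (symmDiff A B).card + 2 * (A ∩ B).card = A.card + B.card := by
  have h1 := card_sdiff_add_card_inter A B
  have h2 := card_sdiff_add_card_inter B A
  rw [inter_comm B A] at h2
  have h3 : (symmDiff A B).card = (A \ B).card + (B \ A).card := by
    rw [symmDiff_def, sup_eq_union, card_union_of_disjoint disjoint_sdiff_sdiff]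
  omega

lemma card_splitEdges_symmDiff_le (S T : Finset (E × Bool)) :
    (splitEdges (symmDiff S T)).card ≤ (splitEdges S).card + (splitEdges T).card := by
  rw [splitEdges_symmDiff]
  have := card_symmDiff_add (splitEdges S) (splitEdges T)
  omega

lemma splitEdges_singleton (h : E × Bool) : splitEdges {h} = {h.1} := by
  ext e
  obtain ⟨e', b⟩ := h
  cases b <;> simp [splitEdges]

lemma even_card_symmDiff_iff {α : Type*} [DecidableEq α] (A B : Finset α) :
    Even (symmDiff A B).card ↔ (Even A.card ↔ Even B.card) := by
  have := card_symmDiff_add A B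
  grind

lemma even_card_splitEdges (T : Finset (E × Bool)) : Even (splitEdges T).card ↔ Even T.card := by
  induction T using Finset.induction_on with
  | empty => simp [splitEdges_empty]
  | insert h T hT ih =>
    have : insert h T = symmDiff {h} T := by
      ext i; simp only [mem_insert, mem_symmDiff, mem_singleton]; grind
    rw [this, splitEdges_symmDiff, even_card_symmDiff_iff, even_card_symmDiff_iff, ih,
      splitEdges_singleton]
    simp

lemma card_splitEdges_le (T : Finset (E × Bool)) : (splitEdges T).card ≤ T.card := by
  induction T using Finset.induction_on with
  | empty => simp [splitEdges_empty]
  | insert h T hT ih =>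
    have : insert h T = symmDiff {h} T := by
      ext i; simp only [mem_insert, mem_symmDiff, mem_singleton]; grind
    have h2 := card_splitEdges_symmDiff_le {h} T
    rw [← this, splitEdges_singleton, card_singleton] at h2
    rw [card_insert_of_notMem hT]
    omega

/-- Toggling a pair that meets a split edge does not create further split edges. -/
lemma card_splitEdges_symmDiff_pair_le {T S : Finset (E × Bool)} (hS : S.card = 2)
    {h : E × Bool} (hh : h ∈ S) (hT : h.1 ∈ splitEdges T) :
    (splitEdges (symmDiff T S)).card ≤ (splitEdges T).card := by
  rw [splitEdges_symmDiff]
  have h1 := card_symmDiff_add (splitEdges T) (splitEdges S)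
  have h2 := card_splitEdges_le S
  -- If `S` splits the edge of `h` too, that edge cancels and at most one new one appears; otherwise
  -- `S` is exactly that edge and splits nothing.
  by_cases h3 : h.1 ∈ splitEdges S
  · have : 0 < (splitEdges T ∩ splitEdges S).card := card_pos.2 ⟨h.1, mem_inter.2 ⟨hT, h3⟩⟩
    omega
  · have h4 : S = {(h.1, false), (h.1, true)} := by
      symm
      apply eq_of_subset_of_card_le
      · obtain ⟨e, b⟩ := h
        simp only [splitEdges, mem_filter, mem_univ, true_and, not_not] at h3
        intro i
        simp only [mem_insert, mem_singleton]
        rintro (rfl | rfl) <;> cases b <;> grind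
      · rw [hS, card_pair (by simp)]
    have h5 : splitEdges S = ∅ := by
      rw [h4]; ext e; simp [splitEdges]
    rw [h5, card_empty, inter_empty, card_empty] at h1
    rw [h5]
    omega

/-- Seen from Ω₀, membership in Ω_k depends on the flipped set alone, so the path constructions
reduce to combinatorics of matchings. -/
lemma disagreements_flip {σ : Config E} (hσ : disagreements σ = 0) (T : Finset (E × Bool)) :
    disagreements (flip σ T) = (splitEdges T).card := by
  have h : ∀ e, σ (e, false) = σ (e, true) := by
    intro e
    by_contra hne
    have := card_eq_zero.1 hσ
    exact absurd (mem_filter.2 ⟨mem_univ e, hne⟩) (by rw [this]; simp)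
  refine congrArg card (filter_congr fun e _ => ?_)
  simp only [flip, h e]
  by_cases h1 : (e, false) ∈ T <;> by_cases h2 : (e, true) ∈ T <;> simp [h1, h2]

end SplitEdges

/-! ### Matchings and their supports -/

section Matching

variable {J : Type*}

/-- `M` consists of pairwise disjoint pairs. -/
def IsMatching (M : Finset (Finset J)) : Prop :=
  (M : Set (Finset J)).PairwiseDisjoint id ∧ ∀ S ∈ M, S.card = 2

lemma IsMatching.subset {M N : Finset (Finset J)} (hM : IsMatching M) (h : N ⊆ M) :
    IsMatching N :=
  ⟨hM.1.subset (by exact_mod_cast h), fun S hS => hM.2 S (h hS)⟩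

variable (J) in
open Classical in
/-- The set of all matchings on `J`. -/
noncomputable def matchings [Fintype J] : Finset (Finset (Finset J)) := {M | IsMatching M}

lemma mem_matchings [Fintype J] {M : Finset (Finset J)} : M ∈ matchings J ↔ IsMatching M := by
  simp [matchings]

variable [DecidableEq J]

/-- The union of the blocks of `M`. -/
def support (M : Finset (Finset J)) : Finset J := M.biUnion id

lemma mem_support {M : Finset (Finset J)} {h : J} : h ∈ support M ↔ ∃ S ∈ M, h ∈ S := by
  simp [support]

lemma IsMatching.card_support {M : Finset (Finset J)} (hM : IsMatching M) :
    (support M).card = 2 * M.card := by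
  rw [support, card_biUnion (fun S hS T hT h => hM.1 hS hT h)]
  simp only [id]
  rw [sum_congr rfl hM.2]; simp [mul_comm]

lemma IsMatching.even_card_support {M : Finset (Finset J)} (hM : IsMatching M) :
    Even (support M).card := by
  rw [hM.card_support]; simp

/-- A position lies in at most one block of `M`, so on subfamilies of `M` taking supports is linear
over 𝔽₂. -/
lemma IsMatching.support_symmDiff {M N K : Finset (Finset J)} (hM : IsMatching M) (hN : N ⊆ M)
    (hK : K ⊆ M) : support (symmDiff N K) = symmDiff (support N) (support K) := by
  have key : ∀ S ∈ M, ∀ T ∈ M, ∀ h, h ∈ S → h ∈ T → S = T := fun S hS T hT h h1 h2 => by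
    by_contra hne
    exact (disjoint_left.1 (hM.1 hS hT hne)) h1 h2
  ext h
  simp only [mem_support, mem_symmDiff]
  constructor
  · rintro ⟨S, (⟨h1, h2⟩ | ⟨h1, h2⟩), h3⟩
    · refine Or.inl ⟨⟨S, h1, h3⟩, ?_⟩
      rintro ⟨T, hT, h4⟩
      exact h2 (key S (hN h1) T (hK hT) h h3 h4 ▸ hT)
    · refine Or.inr ⟨⟨S, h1, h3⟩, ?_⟩
      rintro ⟨T, hT, h4⟩
      exact h2 (key S (hK h1) T (hN hT) h h3 h4 ▸ hT)
  · rintro (⟨⟨S, h1, h3⟩, h2⟩ | ⟨⟨S, h1, h3⟩, h2⟩)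
    · exact ⟨S, Or.inl ⟨h1, fun h4 => h2 ⟨S, h4, h3⟩⟩, h3⟩
    · exact ⟨S, Or.inr ⟨h1, fun h4 => h2 ⟨S, h4, h3⟩⟩, h3⟩

lemma support_singleton (S : Finset J) : support {S} = S := by simp [support]

lemma support_empty : support (∅ : Finset (Finset J)) = ∅ := by simp [support]

lemma IsMatching.support_sdiff {M N : Finset (Finset J)} (hM : IsMatching M) (hN : N ⊆ M) :
    support (M \ N) = symmDiff (support M) (support N) := by
  rw [← hM.support_symmDiff subset_rfl hN, symmDiff_of_ge hN]

lemma IsMatching.support_erase {M : Finset (Finset J)} (hM : IsMatching M) {S : Finset J}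
    (hS : S ∈ M) : support (M.erase S) = symmDiff (support M) S := by
  rw [← sdiff_singleton_eq_erase, hM.support_sdiff (singleton_subset_iff.2 hS), support_singleton]

lemma IsMatching.support_insert {M N : Finset (Finset J)} (hM : IsMatching M) (hN : N ⊆ M)
    {S : Finset J} (hS : S ∈ M) (hSN : S ∉ N) :
    support (insert S N) = symmDiff (support N) S := by
  conv_rhs => rw [← support_singleton S]
  rw [← hM.support_symmDiff hN (singleton_subset_iff.2 hS)]
  congr 1
  ext T; simp only [mem_insert, mem_symmDiff, mem_singleton]; grind

end Matching

/-! ### Ordering and splitting the blocks of a matching -/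

section Winding

variable {E : Type*} [Fintype E] [DecidableEq E]

/-- A nonempty matching with at most two split edges has a block whose removal leaves at most two
split edges. -/
lemma IsMatching.exists_erase {M : Finset (Finset (E × Bool))} (hM : IsMatching M)
    (h2 : (splitEdges (support M)).card ≤ 2) (hne : M.Nonempty) :
    ∃ S ∈ M, (splitEdges (support (M.erase S))).card ≤ 2 := by
  rcases (splitEdges (support M)).eq_empty_or_nonempty with h0 | ⟨e, he⟩
  · obtain ⟨S, hS⟩ := hne
    refine ⟨S, hS, ?_⟩
    rw [hM.support_erase hS]
    have h3 := card_splitEdges_symmDiff_le (support M) S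
    have h4 := card_splitEdges_le S
    rw [hM.2 S hS] at h4
    rw [h0, card_empty] at h3
    omega
  -- When some edge is split, a block meeting it is removed, which cannot raise the number of split
  -- edges.
  · have : ∃ h ∈ support M, h.1 = e := by
      simp only [splitEdges, mem_filter, mem_univ, true_and] at he
      by_cases h1 : (e, false) ∈ support M
      · exact ⟨_, h1, rfl⟩
      · exact ⟨(e, true), by tauto, rfl⟩
    obtain ⟨h, hh, rfl⟩ := this
    obtain ⟨S, hS, hhS⟩ := mem_support.1 hh
    refine ⟨S, hS, ?_⟩
    rw [hM.support_erase hS]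
    exact (card_splitEdges_symmDiff_pair_le (hM.2 S hS) hhS he).trans h2

/-- The blocks of a matching with at most two split edges can be ordered so that all initial
segments have at most two split edges; `pre S` is the set of the blocks that precede `S`. -/
lemma IsMatching.exists_winding_order (M : Finset (Finset (E × Bool))) (hM : IsMatching M)
    (h2 : (splitEdges (support M)).card ≤ 2) :
    ∃ pre : Finset (E × Bool) → Finset (Finset (E × Bool)),
      (∀ S ∈ M, pre S ⊆ M ∧ S ∉ pre S ∧ (splitEdges (support (pre S))).card ≤ 2 ∧
        (splitEdges (support (insert S (pre S)))).card ≤ 2) ∧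
      ∀ g : Finset (Finset (E × Bool)) → ℝ,
        ∑ S ∈ M, (g (insert S (pre S)) - g (pre S)) = g M - g ∅ := by
  induction hn : M.card generalizing M with
  | zero =>
    rw [card_eq_zero] at hn
    subst hn
    exact ⟨fun _ => ∅, by simp, by simp⟩
  | succ n ih =>
    obtain ⟨S, hS, hS2⟩ := hM.exists_erase h2 (card_pos.1 (by omega))
    obtain ⟨pre, h3, h4⟩ := ih (M.erase S) (hM.subset (erase_subset _ _)) hS2
      (by rw [card_erase_of_mem hS]; omega)
    -- The removed block comes last: all other blocks precede it.
    refine ⟨Function.update pre S (M.erase S), ?_, ?_⟩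
    · intro T hT
      by_cases hTS : T = S
      · subst hTS
        simp only [Function.update_self]
        refine ⟨erase_subset _ _, notMem_erase _ _, hS2, ?_⟩
        rwa [insert_erase hS]
      · rw [Function.update_of_ne hTS]
        obtain ⟨h5, h6⟩ := h3 T (mem_erase.2 ⟨hTS, hT⟩)
        exact ⟨h5.trans (erase_subset _ _), h6⟩
    · intro g
      rw [← add_sum_erase _ _ hS]
      have : ∑ T ∈ M.erase S, (g (insert T (Function.update pre S (M.erase S) T)) -
          g (Function.update pre S (M.erase S) T)) = g (M.erase S) - g ∅ := by
        rw [← h4 g]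
        refine sum_congr rfl fun T hT => ?_
        rw [Function.update_of_ne (ne_of_mem_erase hT)]
      rw [this, Function.update_self, insert_erase hS]
      ring

/-- `N` grows block by block with `e` kept split. If the second split edge of `N` is also split by
`M`, the complement has 4 + 2 - 4 = 2 split edges and the cut is found. Otherwise that edge is split
by `M \ N` as well, and moving a block that meets it into `N` raises neither count. -/
lemma IsMatching.exists_split_of_subset {M : Finset (Finset (E × Bool))} (hM : IsMatching M)
    (h4 : (splitEdges (support M)).card = 4) {e : E} (he : e ∈ splitEdges (support M))
    (N : Finset (Finset (E × Bool))) (hN : N ⊆ M) (heN : e ∈ splitEdges (support N))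
    (hN2 : (splitEdges (support N)).card = 2)
    (hN4 : (splitEdges (support (M \ N))).card ≤ 4) :
    ∃ K ⊆ M, (splitEdges (support K)).card = 2 ∧ (splitEdges (support (M \ K))).card = 2 := by
  induction hn : (M \ N).card using Nat.strong_induction_on generalizing N with
  | _ n ih =>
    have hev : Even (splitEdges (support (M \ N))).card :=
      (even_card_splitEdges _).2 (hM.subset sdiff_subset).even_card_support
    have hsd := hM.support_sdiff hN
    have hcard := card_symmDiff_add (splitEdges (support M)) (splitEdges (support N))
    rw [← splitEdges_symmDiff, ← hsd] at hcard
    by_cases hd : (splitEdges (support (M \ N))).card = 2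
    · exact ⟨N, hN, hN2, hd⟩
    have hle : (splitEdges (support M) ∩ splitEdges (support N)).card ≤ 1 := by
      have : (splitEdges (support (M \ N))).card ≠ 3 := fun h => by rw [h] at hev; revert hev; decide
      have := card_pos.2 ⟨e, mem_inter.2 ⟨he, heN⟩⟩
      have h5 : (splitEdges (support (M \ N))).card ≠ 1 := fun h => by
        rw [h] at hev; revert hev; decide
      have h6 : (splitEdges (support M) ∩ splitEdges (support N)).card ≤ 2 :=
        hN2 ▸ card_le_card inter_subset_right
      omega
    obtain ⟨e', he', hne⟩ : ∃ e' ∈ splitEdges (support N), e' ∉ splitEdges (support M) := by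
      by_contra hcon
      push Not at hcon
      rw [inter_eq_right.2 hcon] at hle
      omega
    have hmem : e' ∈ splitEdges (support (M \ N)) := by
      rw [hsd, splitEdges_symmDiff, mem_symmDiff]; exact Or.inr ⟨he', hne⟩
    obtain ⟨h, hh, rfl⟩ : ∃ h ∈ support (M \ N), h.1 = e' := by
      simp only [splitEdges, mem_filter, mem_univ, true_and] at hmem
      by_cases h1 : (e', false) ∈ support (M \ N)
      · exact ⟨_, h1, rfl⟩
      · exact ⟨(e', true), by tauto, rfl⟩
    obtain ⟨S, hS, hhS⟩ := mem_support.1 hh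
    obtain ⟨hSM, hSN⟩ := mem_sdiff.1 hS
    have hins := hM.support_insert hN hSM hSN
    have hsub : insert S N ⊆ M := insert_subset hSM hN
    have hers : M \ insert S N = (M \ N).erase S := by
      ext T; simp only [mem_sdiff, mem_insert, mem_erase]; tauto
    -- `support M` has just one half-edge of `e`, and `support N` already contains it.
    have heS : e ∈ splitEdges (support (insert S N)) := by
      simp only [splitEdges, mem_filter, mem_univ, true_and, mem_support] at he heN ⊢
      grind
    refine ih _ ?_ (insert S N) hsub heS ?_ ?_ rfl
    · rw [← hn, hers, card_erase_of_mem hS]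
      have := card_pos.2 ⟨S, hS⟩
      omega
    -- The count is at most two, even, and positive because of `e`.
    · have h5 := card_splitEdges_symmDiff_pair_le (hM.2 S hSM) hhS he'
      rw [← hins, hN2] at h5
      have h6 := card_pos.2 ⟨e, heS⟩
      have h7 := (even_card_splitEdges _).2 (hM.subset hsub).even_card_support
      have : (splitEdges (support (insert S N))).card ≠ 1 := fun h => by
        rw [h] at h7; revert h7; decide
      omega
    · rw [hers, (hM.subset sdiff_subset).support_erase hS]
      exact (card_splitEdges_symmDiff_pair_le (hM.2 S hSM) hhS hmem).trans hN4

/-- A matching with four split edges falls into two parts with two split edges each. -/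
lemma IsMatching.exists_split {M : Finset (Finset (E × Bool))} (hM : IsMatching M)
    (h4 : (splitEdges (support M)).card = 4) :
    ∃ K ⊆ M, (splitEdges (support K)).card = 2 ∧ (splitEdges (support (M \ K))).card = 2 := by
  obtain ⟨e, he⟩ : (splitEdges (support M)).Nonempty := card_pos.1 (by omega)
  obtain ⟨h, hh, rfl⟩ : ∃ h ∈ support M, h.1 = e := by
    have hmem := he
    simp only [splitEdges, mem_filter, mem_univ, true_and] at hmem
    by_cases h1 : (e, false) ∈ support M
    · exact ⟨_, h1, rfl⟩
    · exact ⟨(e, true), by tauto, rfl⟩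
  obtain ⟨S, hS, hhS⟩ := mem_support.1 hh
  have hsub : {S} ⊆ M := singleton_subset_iff.2 hS
  have heS : h.1 ∈ splitEdges (support {S}) := by
    have hsup : ∀ i ∈ S, i ∈ support M := fun i hi => mem_support.2 ⟨S, hS, hi⟩
    rw [support_singleton]
    simp only [splitEdges, mem_filter, mem_univ, true_and] at he ⊢
    obtain ⟨e, b⟩ := h
    cases b <;> grind
  refine hM.exists_split_of_subset h4 he {S} hsub heS ?_ ?_
  · have h5 := card_splitEdges_le S
    have h6 := card_pos.2 ⟨_, heS⟩
    have h7 := (even_card_splitEdges S).2 (by rw [hM.2 S hS]; decide)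
    rw [support_singleton] at h6 ⊢
    rw [hM.2 S hS] at h5
    have : (splitEdges S).card ≠ 1 := fun h => by rw [h] at h7; revert h7; decide
    omega
  · rw [sdiff_singleton_eq_erase, hM.support_erase hS, ← h4]
    exact card_splitEdges_symmDiff_pair_le (hM.2 S hS) hhS he

end Winding

/-! ### From windings at the vertices to one global winding -/

section Fiber

variable {J V : Type*} [DecidableEq V] (p : J → V)

/-- The part of `S` that lies over `v`. -/
def fiberPart (v : V) (S : Finset J) : Finset {h : J // p h = v} := S.subtype fun h => p h = v

lemma mem_fiberPart {v : V} {S : Finset J} {h : {h : J // p h = v}} :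
    h ∈ fiberPart p v S ↔ h.1 ∈ S := by
  simp [fiberPart]

end Fiber

section Windable

variable {J : Type*} [DecidableEq J]

/-- `b` splits the products of two values of `w`, on configurations that differ in an even number
of positions, over the matchings of the difference, invariantly under flips of blocks. -/
structure IsWinding [Fintype J] (w : (J → Bool) → ℝ) (b : (J → Bool) → Finset (Finset J) → ℝ) : Prop where
  nonneg : ∀ x M, 0 ≤ b x M
  mul_eq_sum : ∀ x D, Even D.card → w x * w (flip x D) =
    ∑ M ∈ matchings J with support M = D, b x M
  flip_block : ∀ x M, IsMatching M → ∀ S ∈ M, b (flip x S) M = b x M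

lemma exists_matching_of_even (A : Finset J) (hA : Even A.card) :
    ∃ M, IsMatching M ∧ support M = A := by
  induction hn : A.card using Nat.strong_induction_on generalizing A with
  | _ n ih =>
    rcases A.eq_empty_or_nonempty with rfl | hne
    · exact ⟨∅, ⟨by simp, by simp⟩, support_empty⟩
    · have h1 : 1 < A.card := by
        have h0 := card_pos.2 hne
        obtain ⟨r, hr⟩ := hA
        omega
      obtain ⟨a, ha, b, hb, hab⟩ := one_lt_card.1 h1
      have hsub : ({a, b} : Finset J) ⊆ A := by simp [insert_subset_iff, ha, hb]
      have hcard := card_sdiff_add_card_eq_card hsub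
      rw [card_pair hab] at hcard
      obtain ⟨M, hM, hMs⟩ := ih (A \ {a, b}).card (by omega) (A \ {a, b})
        (by obtain ⟨r, hr⟩ := hA; exact ⟨r - 1, by omega⟩) rfl
      refine ⟨insert {a, b} M, ⟨?_, ?_⟩, ?_⟩
      · rw [coe_insert]
        refine hM.1.insert fun S hS _ => ?_
        have : S ⊆ A \ {a, b} := hMs ▸ subset_biUnion_of_mem id hS
        exact disjoint_of_subset_right this disjoint_sdiff
      · intro S hS
        rcases mem_insert.1 hS with rfl | hS
        · exact card_pair hab
        · exact hM.2 S hS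
      · rw [support, biUnion_insert, ← support, hMs, id, union_sdiff_of_subset hsub]

/-- A partition of a set of even size into pairs and singletons can be coarsened to a partition
into pairs. -/
lemma exists_matching_of_partition (P : Finset (Finset J))
    (hd : (P : Set (Finset J)).PairwiseDisjoint id) (hc : ∀ A ∈ P, A.card = 1 ∨ A.card = 2)
    (hev : Even (support P).card) :
    ∃ M, IsMatching M ∧ support M = support P ∧
      ∀ S ∈ M, S ∈ P ∨ ∃ i j, i ≠ j ∧ {i} ∈ P ∧ {j} ∈ P ∧ S = {i, j} := by
  have hPm : IsMatching (P.filter fun S => S.card = 2) :=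
    ⟨hd.subset fun S hS => (mem_filter.1 hS).1, fun S hS => (mem_filter.1 hS).2⟩
  have key : ∀ S ∈ P, ∀ T ∈ P, ∀ h, h ∈ S → h ∈ T → S = T := fun S hS T hT h h1 h2 => by
    by_contra hne
    exact (disjoint_left.1 (hd hS hT hne)) h1 h2
  set A := (support P).filter fun i => {i} ∈ P with hAdef
  have hsing : ∀ {i}, i ∈ A ↔ {i} ∈ P := by
    intro i
    rw [hAdef, mem_filter, mem_support]
    exact ⟨fun h => h.2, fun h => ⟨⟨{i}, h, mem_singleton_self i⟩, h⟩⟩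
  have hdisj : Disjoint (support (P.filter fun S => S.card = 2)) A := by
    rw [disjoint_left]
    intro i hi hiA
    obtain ⟨S, hS, hiS⟩ := mem_support.1 hi
    have := key S (mem_filter.1 hS).1 {i} (hsing.1 hiA) i hiS (mem_singleton_self i)
    have h2 := (mem_filter.1 hS).2
    rw [this] at h2
    simp at h2
  have hunion : support (P.filter fun S => S.card = 2) ∪ A = support P := by
    ext i
    simp only [mem_union, mem_support, hsing, mem_filter]
    constructor
    · rintro (⟨S, hS, hi⟩ | h)
      · exact ⟨S, hS.1, hi⟩
      · exact ⟨{i}, h, mem_singleton_self i⟩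
    · rintro ⟨S, hS, hi⟩
      rcases hc S hS with h | h
      · obtain ⟨j, rfl⟩ := card_eq_one.1 h
        rw [mem_singleton] at hi
        subst hi
        exact Or.inr hS
      · exact Or.inl ⟨S, ⟨hS, h⟩, hi⟩
  -- The pairs cover an even number of positions, so the singletons are even in number and can be
  -- matched with each other.
  have hAev : Even A.card := by
    rw [← hunion, card_union_of_disjoint hdisj, Nat.even_add] at hev
    exact hev.1 hPm.even_card_support
  obtain ⟨M, hM, hMA⟩ := exists_matching_of_even A hAev
  refine ⟨(P.filter fun S => S.card = 2) ∪ M, ⟨?_, ?_⟩, ?_, ?_⟩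
  · rw [coe_union, Set.pairwiseDisjoint_union]
    refine ⟨hPm.1, hM.1, fun S hS T hT _ => ?_⟩
    exact disjoint_of_subset_left (subset_biUnion_of_mem id hS)
      (disjoint_of_subset_right (hMA ▸ subset_biUnion_of_mem id hT) hdisj)
  · intro S hS
    rcases mem_union.1 hS with hS | hS
    exacts [hPm.2 S hS, hM.2 S hS]
  · rw [← hunion, ← hMA]
    exact union_biUnion
  · intro S hS
    rcases mem_union.1 hS with hS | hS
    · exact Or.inl (mem_filter.1 hS).1
    · obtain ⟨i, j, hij, rfl⟩ := card_eq_two.1 (hM.2 S hS)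
      refine Or.inr ⟨i, j, hij, hsing.1 ?_, hsing.1 ?_, rfl⟩ <;> rw [← hMA, mem_support] <;>
        exact ⟨_, hS, by simp⟩

variable {V : Type*} [DecidableEq V] (p : J → V)

lemma flip_fiberPart (x : J → Bool) (S : Finset J) (v : V) :
    (fun h : {h : J // p h = v} => flip x S h.1) =
      flip (fun h : {h : J // p h = v} => x h.1) (fiberPart p v S) := by
  funext h
  simp [flip, mem_fiberPart]

variable [Fintype J] [Fintype V]

/-- Pairings over the fibers of `p` combine into one matching, each of whose blocks meets every
fiber in a block of its pairing, or not at all. -/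
lemma exists_matching_of_pairings (D : Finset J) (hD : Even D.card)
    (k : (v : V) → Finset (Finset {h : J // p h = v}))
    (hk : ∀ v, k v ∈ pairings (fiberPart p v D)) :
    ∃ M, IsMatching M ∧ support M = D ∧
      ∀ S ∈ M, ∀ v, fiberPart p v S = ∅ ∨ fiberPart p v S ∈ k v := by
  have hk' : ∀ v, IsPairing (fiberPart p v D) (k v) := fun v => by
    classical exact (mem_filter.1 (hk v)).2
  set P : Finset (Finset J) :=
    univ.biUnion fun v => (k v).image fun A => A.map (Function.Embedding.subtype _) with hP
  have hmem : ∀ {A}, A ∈ P ↔ ∃ v, ∃ B ∈ k v, B.map (Function.Embedding.subtype _) = A := by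
    intro A; simp [hP]
  have hover : ∀ {v} {B : Finset {h : J // p h = v}} {i},
      i ∈ B.map (Function.Embedding.subtype _) → p i = v := by
    intro v B i hi
    obtain ⟨j, -, rfl⟩ := mem_map.1 hi
    exact j.2
  have hres : ∀ {v} (B : Finset {h : J // p h = v}),
      fiberPart p v (B.map (Function.Embedding.subtype _)) = B := by
    intro v B
    ext h
    rw [mem_fiberPart]
    exact mem_map' (Function.Embedding.subtype _)
  have hres0 : ∀ {v u} (B : Finset {h : J // p h = v}), u ≠ v →
      fiberPart p u (B.map (Function.Embedding.subtype _)) = ∅ := by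
    intro v u B huv
    refine eq_empty_of_forall_notMem fun h hh => huv ?_
    rw [mem_fiberPart] at hh
    exact h.2.symm.trans (hover hh)
  have hsupp : support P = D := by
    ext i
    have h1 : i ∈ D ↔ ∃ B ∈ k (p i), (⟨i, rfl⟩ : {h : J // p h = p i}) ∈ B := by
      rw [← mem_fiberPart p (v := p i) (h := ⟨i, rfl⟩), ← (hk' (p i)).2.1]
      simp
    rw [h1, mem_support]
    constructor
    · rintro ⟨S, hS, hi⟩
      obtain ⟨v, B, hB, rfl⟩ := hmem.1 hS
      obtain rfl := hover hi
      refine ⟨B, hB, ?_⟩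
      rwa [← hres B, mem_fiberPart]
    · rintro ⟨B, hB, hi⟩
      exact ⟨_, hmem.2 ⟨_, B, hB, rfl⟩, mem_map_of_mem (Function.Embedding.subtype _) hi⟩
  have hdisj : (P : Set (Finset J)).PairwiseDisjoint id := by
    intro S hS T hT hne
    obtain ⟨v, B, hB, rfl⟩ := hmem.1 hS
    obtain ⟨u, C, hC, rfl⟩ := hmem.1 hT
    by_cases huv : u = v
    · subst huv
      have : B ≠ C := fun h => hne (by rw [h])
      exact (disjoint_map _).2 ((hk' u).1 hB hC this)
    · rw [Function.onFun, id, id, disjoint_left]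
      intro i hi hi'
      exact huv ((hover hi').symm.trans (hover hi))
  obtain ⟨M, hM, hMs, hMb⟩ := exists_matching_of_partition P hdisj (by
    intro A hA
    obtain ⟨v, B, hB, rfl⟩ := hmem.1 hA
    rw [card_map]
    exact (hk' v).2.2.1 B hB) (by rwa [hsupp])
  refine ⟨M, hM, hMs.trans hsupp, fun S hS v => ?_⟩
  have hone : ∀ A ∈ P, fiberPart p v A = ∅ ∨ fiberPart p v A ∈ k v := by
    intro A hA
    obtain ⟨u, B, hB, rfl⟩ := hmem.1 hA
    by_cases huv : v = u
    · subst huv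
      rw [hres]; exact Or.inr hB
    · exact Or.inl (hres0 B huv)
  rcases hMb S hS with h | ⟨i, j, hij, hi, hj, rfl⟩
  · exact hone S h
  · have hfib : fiberPart p v {i, j} = fiberPart p v {i} ∪ fiberPart p v {j} := by
      ext h; simp [mem_fiberPart]
    have hcard : ∀ a, fiberPart p v {a} ≠ ∅ → (fiberPart p v {a}).card = 1 := by
      intro a ha
      have h1 : (fiberPart p v {a}).card ≤ 1 := by
        rw [fiberPart, card_subtype]
        exact (card_filter_le _ _).trans (by simp)
      have h2 := card_pos.2 (nonempty_iff_ne_empty.2 ha)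
      omega
    rcases hone _ hi with h1 | h1
    · rw [hfib, h1, empty_union]; exact hone _ hj
    rcases hone _ hj with h2 | h2
    · rw [hfib, h2, union_empty]; exact hone _ hi
    by_cases e1 : fiberPart p v {i} = ∅
    · rw [hfib, e1, empty_union]; exact hone _ hj
    by_cases e2 : fiberPart p v {j} = ∅
    · rw [hfib, e2, union_empty]; exact hone _ hi
    -- A pairing has at most one singleton, so two joined singletons cannot lie over the same
    -- vertex.
    have h3 := card_le_one.1 (hk' v).2.2.2 _ (mem_filter.2 ⟨h1, hcard i e1⟩) _
      (mem_filter.2 ⟨h2, hcard j e2⟩)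
    exfalso
    obtain ⟨h, hh⟩ := nonempty_iff_ne_empty.2 e1
    have hhj := h3 ▸ hh
    rw [mem_fiberPart, mem_singleton] at hh hhj
    exact hij (hh.symm.trans hhj)

/-- A product of windable functions of disjoint groups of variables winds along matchings, on the
pairs of configurations that differ in an even number of positions. -/
lemma exists_isWinding (f : (v : V) → ({h : J // p h = v} → Bool) → ℝ)
    (hf : ∀ v, Windable (f v)) :
    ∃ b, IsWinding (fun x : J → Bool => ∏ v, f v fun h => x h.1) b := by
  classical
  choose B hB0 hB1 hB2 using hf
  have hex := exists_matching_of_pairings p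
  choose! blk hblk1 hblk2 hblk3 using hex
  -- `blk` fixes one coarsening for each family of local pairings; b(x, M) collects the products of
  -- local values over all families coarsened to `M`.
  refine ⟨fun x M => ∑ k ∈ (Fintype.piFinset fun v => pairings (fiberPart p v (support M))) with
    blk (support M) k = M, ∏ v, B v (fun h => x h.1)
      (flip (fun h => x h.1) (fiberPart p v (support M))) (k v), ?_, ?_, ?_⟩
  · intro x M
    refine sum_nonneg fun k hk => prod_nonneg fun v _ => hB0 _ _ _ _ ?_
    rw [diff_flip]
    exact Fintype.mem_piFinset.1 (mem_filter.1 hk).1 v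
  · intro x D hD
    have h1 : (∏ v, f v fun h => x h.1) * (∏ v, f v fun h => flip x D h.1) =
        ∏ v, ∑ M ∈ pairings (fiberPart p v D), B v (fun h => x h.1)
          (flip (fun h => x h.1) (fiberPart p v D)) M := by
      rw [← prod_mul_distrib]
      refine prod_congr rfl fun v _ => ?_
      rw [flip_fiberPart, hB1, diff_flip]
    rw [h1, prod_univ_sum, ← sum_fiberwise_of_maps_to
      (t := (matchings J).filter fun M => support M = D) (g := blk D)]
    · refine sum_congr rfl fun M hM => ?_
      rw [(mem_filter.1 hM).2]
    · intro k hk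
      have hk' := fun v => Fintype.mem_piFinset.1 hk v
      exact mem_filter.2 ⟨mem_matchings.2 (hblk1 D hD k hk'), hblk2 D hD k hk'⟩
  · intro x M hM S hS
    refine sum_congr rfl fun k hk => prod_congr rfl fun v _ => ?_
    obtain ⟨hk1, hk2⟩ := mem_filter.1 hk
    have hk' := fun v => Fintype.mem_piFinset.1 hk1 v
    have hev := hM.even_card_support
    rw [flip_fiberPart]
    -- At each vertex, `S` either changes nothing or flips a block of the local pairing, under which
    -- the local `B` is invariant.
    rcases hblk3 _ hev k hk' S (hk2.symm ▸ hS) v with h | h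
    · rw [h, flip_empty]
    · have h2 := hB2 v (fun h => x h.1) (flip (fun h => x h.1) (fiberPart p v (support M))) (k v)
        (by rw [diff_flip]; exact hk' v) _ h
      rw [h2, flip_flip, flip_flip, symmDiff_comm]

end Windable

/-! ### Flow along windings and its congestion -/

namespace IsWinding

section

variable {J : Type*} [DecidableEq J] [Fintype J] {w : (J → Bool) → ℝ}
  {b : (J → Bool) → Finset (Finset J) → ℝ}

/-- This allows the flow of a path to be charged to any configuration on the path. -/
lemma flip_support (hb : IsWinding w b) {M : Finset (Finset J)} (hM : IsMatching M)
    (x : J → Bool) {N : Finset (Finset J)} (hN : N ⊆ M) : b (flip x (support N)) M = b x M := by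
  induction N using Finset.induction_on with
  | empty => rw [support_empty, flip_empty]
  | insert S N hS ih =>
    have hN' := (insert_subset_iff.1 hN)
    rw [hM.support_insert hN'.2 hN'.1 hS, ← flip_flip, hb.flip_block _ _ hM _ hN'.1, ih hN'.2]

lemma sum_mul_eq (hb : IsWinding w b) (x : J → Bool) (q : (J → Bool) → Prop) [DecidablePred q]
    (hq : ∀ y, q y → Even (diff x y).card) (G : (J → Bool) → ℝ) :
    ∑ y with q y, w x * w y * G y =
      ∑ M ∈ matchings J with q (flip x (support M)), b x M * G (flip x (support M)) := by
  rw [sum_filter, ← (flipEquiv x).sum_comp, ← sum_fiberwise_of_maps_to (t := univ) (g := support)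
    (fun _ _ => mem_univ _)]
  refine sum_congr rfl fun D _ => ?_
  change (if q (flip x D) then w x * w (flip x D) * G (flip x D) else 0) = _
  rw [filter_filter]
  split_ifs with h
  · have hD := hq _ h
    rw [diff_flip] at hD
    rw [hb.mul_eq_sum x D hD, sum_mul]
    refine (sum_congr (filter_congr fun M _ => ?_) fun M hM => ?_)
    · exact ⟨fun h2 => ⟨by rwa [h2], h2⟩, fun h2 => h2.2⟩
    · rw [(mem_filter.1 hM).2.2]
  · symm
    refine sum_eq_zero fun M hM => absurd ?_ h
    obtain ⟨h1, h2⟩ := (mem_filter.1 hM).2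
    rwa [h2] at h1

/-- Each matching contributes to the product of w(x) with the weight of its partner; partners at odd
distance only enlarge the right-hand side. -/
lemma sum_le_mul_sum (hb : IsWinding w b) (hw : ∀ x, 0 ≤ w x) (x : J → Bool)
    (q : (J → Bool) → Prop) [DecidablePred q] :
    ∑ M ∈ matchings J with q (flip x (support M)), b x M ≤ w x * ∑ y with q y, w y := by
  have h := hb.sum_mul_eq x (fun y => q y ∧ Even (diff x y).card) (fun y h => h.2) (fun _ => 1)
  simp only [mul_one] at h
  have h2 : ∑ M ∈ matchings J with q (flip x (support M)), b x M =
      ∑ M ∈ matchings J with (q (flip x (support M)) ∧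
        Even (diff x (flip x (support M))).card), b x M := by
    refine sum_congr (filter_congr fun M hM => ?_) fun _ _ => rfl
    rw [diff_flip]
    exact ⟨fun h => ⟨h, (mem_matchings.1 hM).even_card_support⟩, fun h => h.1⟩
  rw [h2, ← h, mul_sum]
  refine sum_le_sum_of_subset_of_nonneg (fun y hy => ?_) fun y _ _ => mul_nonneg (hw _) (hw _)
  exact mem_filter.2 ⟨mem_univ _, (mem_filter.1 hy).2.1⟩

/-- Congestion of a single move: as `S` is a block of `M`, b takes the same value at both ends, so
the sum can be bounded from either end. -/
lemma sum_le_min_mul_sum (hb : IsWinding w b) (hw : ∀ x, 0 ≤ w x) (x : J → Bool) (S : Finset J)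
    (r : (J → Bool) → Prop) [DecidablePred r] :
    ∑ M ∈ matchings J with
      S ∈ M ∧ r (flip x (support M)) ∧ r (flip (flip x S) (support M)), b x M ≤
      min (w x) (w (flip x S)) * ∑ y with r y, w y := by
  rw [min_mul_of_nonneg _ _ (sum_nonneg fun y _ => hw y)]
  refine le_min ?_ ?_
  · refine le_trans ?_ (hb.sum_le_mul_sum hw x r)
    refine sum_le_sum_of_subset_of_nonneg (fun M hM => ?_) fun M _ _ => hb.nonneg x M
    have h := mem_filter.1 hM
    exact mem_filter.2 ⟨h.1, h.2.2.1⟩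
  · refine le_trans ?_ (hb.sum_le_mul_sum hw (flip x S) r)
    refine le_trans (le_of_eq (sum_congr rfl fun M hM => ?_))
      (sum_le_sum_of_subset_of_nonneg (f := b (flip x S)) (fun M hM => ?_)
        fun M _ _ => hb.nonneg _ M)
    · have h := mem_filter.1 hM
      exact (hb.flip_block x M (mem_matchings.1 h.1) S h.2.1).symm
    · have h := mem_filter.1 hM
      exact mem_filter.2 ⟨h.1, h.2.2.2⟩

/-- The total flow through the moves inside `q`, when the complementary configurations are
in `r`. -/
lemma sum_blocks_le (hb : IsWinding w b) (hw : ∀ x, 0 ≤ w x) (q r : (J → Bool) → Prop)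
    [DecidablePred q] [DecidablePred r] (F : (J → Bool) → ℝ) {s : Finset (Finset (Finset J))}
    (hs : s ⊆ matchings J) :
    ∑ M ∈ s, ∑ S ∈ M, ∑ a with q a ∧ q (flip a S) ∧ r (flip a (support M)) ∧
        r (flip (flip a S) (support M)), b a M * (F (flip a S) - F a) ^ 2 ≤
      (∑ y with r y, w y) * ∑ a with q a, ∑ c with q c ∧ hammingDist a c = 2,
        min (w a) (w c) * (F c - F a) ^ 2 := by
  have h1 : ∀ M ∈ s, ∑ S ∈ M, ∑ a with q a ∧ q (flip a S) ∧ r (flip a (support M)) ∧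
      r (flip (flip a S) (support M)), b a M * (F (flip a S) - F a) ^ 2 =
      ∑ a with q a, ∑ S ∈ M with q (flip a S) ∧ r (flip a (support M)) ∧
        r (flip (flip a S) (support M)), b a M * (F (flip a S) - F a) ^ 2 := by
    intro M _
    refine sum_comm' fun S a => ?_
    simp only [mem_filter, mem_univ, true_and]
    tauto
  rw [sum_congr rfl h1, sum_comm, mul_sum]
  refine sum_le_sum fun a _ => ?_
  -- For fixed `a`, the block `S` determines the other end c = a ⊕ S; the inner sum over `M` is then
  -- the congestion of that move.
  rw [sum_comm' (t' := univ.filter fun S : Finset J => q (flip a S) ∧ S.card = 2)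
    (s' := fun S => s.filter fun M => S ∈ M ∧ r (flip a (support M)) ∧
      r (flip (flip a S) (support M)))]
  · rw [mul_sum, sum_filter, sum_filter, ← (flipEquiv a).sum_comp]
    refine sum_le_sum fun S _ => ?_
    change _ ≤ if q (flip a S) ∧ hammingDist a (flip a S) = 2 then
      _ * (min (w a) (w (flip a S)) * (F (flip a S) - F a) ^ 2) else 0
    rw [hammingDist_flip]
    split_ifs with h
    · rw [← sum_mul, ← mul_assoc, mul_comm (∑ y with r y, w y)]
      refine mul_le_mul_of_nonneg_right (le_trans ?_ (hb.sum_le_min_mul_sum hw a S r)) (sq_nonneg _)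
      exact sum_le_sum_of_subset_of_nonneg (filter_subset_filter _ hs) fun M _ _ => hb.nonneg _ _
    · exact le_rfl
  · intro M S
    simp only [mem_filter, mem_univ, true_and]
    constructor
    · rintro ⟨h1, h2, h3, h4⟩
      exact ⟨⟨h1, h2, h4⟩, h3, (mem_matchings.1 (hs h1)).2 S h2⟩
    · rintro ⟨⟨h1, h2, h4⟩, h3, -⟩
      exact ⟨h1, h2, h3, h4⟩

end

/-- For a fixed matching, and a fixed block where there is one, the start of a path is recovered
from the intermediate configuration, so nothing is counted twice. -/
lemma sum_flip_le {J : Type*} [DecidableEq J] [Fintype J] {s t : Finset (J → Bool)}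
    {g : (J → Bool) → ℝ} (T : Finset J) (h : ∀ x ∈ s, flip x T ∈ t) (hg : ∀ x, 0 ≤ g x) :
    ∑ x ∈ s, g (flip x T) ≤ ∑ x ∈ t, g x := by
  rw [← sum_image (g := fun x => flip x T) ((flip_injective T).injOn)]
  refine sum_le_sum_of_subset_of_nonneg (fun y hy => ?_) fun y _ _ => hg y
  obtain ⟨x, hx, rfl⟩ := mem_image.1 hy
  exact h x hx

variable {E : Type*} [Fintype E] [DecidableEq E] {w : Config E → ℝ}
  {b : Config E → Finset (Finset (E × Bool)) → ℝ}

lemma even_card_diff {x y : Config E} (hx : disagreements x = 0) (hy : Even (disagreements y)) :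
    Even (diff x y).card := by
  rw [← even_card_splitEdges, ← disagreements_flip hx, flip_diff]
  exact hy

/-- Splitting the difference of a configuration in `Ω₀` and one in `Ω₄` gives two in `Ω₂`. -/
lemma sum_zero_mul_sum_four_le (hb : IsWinding w b) (hw : ∀ x, 0 ≤ w x) :
    (∑ σ : Config E with disagreements σ = 0, w σ) * (∑ σ : Config E with disagreements σ = 4, w σ) ≤
      (∑ σ : Config E with disagreements σ = 2, w σ) ^ 2 := by
  have hK : ∀ M : Finset (Finset (E × Bool)), ∃ K, IsMatching M →
      (splitEdges (support M)).card = 4 → K ⊆ M ∧ (splitEdges (support K)).card = 2 ∧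
        (splitEdges (support (M \ K))).card = 2 := by
    intro M
    by_cases h : IsMatching M ∧ (splitEdges (support M)).card = 4
    · obtain ⟨K, hK⟩ := h.1.exists_split h.2
      exact ⟨K, fun _ _ => hK⟩
    · exact ⟨∅, fun h1 h2 => absurd ⟨h1, h2⟩ h⟩
  choose K hK using hK
  calc _ = ∑ x : Config E with disagreements x = 0,
        ∑ M ∈ matchings (E × Bool) with (splitEdges (support M)).card = 4,
          b (flip x (support (K M))) M := by
        rw [sum_mul_sum]
        refine sum_congr rfl fun x hx => ?_
        have hx := (mem_filter.1 hx).2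
        have h := hb.sum_mul_eq x (fun y => disagreements y = 4)
          (fun y hy => even_card_diff hx (by rw [hy]; decide)) (fun _ => 1)
        simp only [mul_one] at h
        rw [h]
        refine sum_congr (filter_congr fun M _ => by rw [disagreements_flip hx]) fun M hM => ?_
        obtain ⟨h1, h2⟩ := mem_filter.1 hM
        rw [mem_matchings] at h1
        exact (hb.flip_support h1 x (hK M h1 h2).1).symm
    _ ≤ ∑ M ∈ matchings (E × Bool) with (splitEdges (support M)).card = 4,
          ∑ x : Config E with disagreements x = 2 ∧ disagreements (flip x (support M)) = 2,
            b x M := by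
        rw [sum_comm]
        refine sum_le_sum fun M hM => ?_
        obtain ⟨h1, h2⟩ := mem_filter.1 hM
        rw [mem_matchings] at h1
        obtain ⟨h3, h4, h5⟩ := hK M h1 h2
        refine sum_flip_le (g := fun x => b x M) _ (fun x hx => ?_) fun x => hb.nonneg x M
        have hx := (mem_filter.1 hx).2
        -- Flipping all of `M` turns `x` flipped on `K` into `x` flipped on `M \ K`; both have two
        -- disagreements.
        refine mem_filter.2 ⟨mem_univ _, ?_, ?_⟩
        · rw [disagreements_flip hx, h4]
        · rw [flip_flip, symmDiff_comm, ← h1.support_sdiff h3, disagreements_flip hx, h5]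
    _ ≤ ∑ x : Config E with disagreements x = 2,
        ∑ M ∈ matchings (E × Bool) with
          disagreements (flip x (support M)) = 2, b x M := by
        rw [sum_comm' (t' := univ.filter fun x : Config E => disagreements x = 2)
          (s' := fun x => (matchings (E × Bool)).filter fun M =>
            disagreements (flip x (support M)) = 2 ∧ (splitEdges (support M)).card = 4)]
        · refine sum_le_sum fun x _ => sum_le_sum_of_subset_of_nonneg (fun M hM => ?_)
            fun M _ _ => hb.nonneg x M
          exact mem_filter.2 ⟨(mem_filter.1 hM).1, (mem_filter.1 hM).2.1⟩
        · intro M x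
          simp only [mem_filter, mem_univ, true_and]
          tauto
    _ ≤ ∑ x : Config E with disagreements x = 2,
          w x * ∑ σ : Config E with disagreements σ = 2, w σ :=
        sum_le_sum fun x _ => hb.sum_le_mul_sum hw x fun y => disagreements y = 2
    _ = _ := by rw [← sum_mul, sq]

lemma card_le_of_isMatching {M : Finset (Finset (E × Bool))} (hM : IsMatching M) :
    M.card ≤ Fintype.card E := by
  have h1 := hM.card_support
  have h2 := card_le_univ (support M)
  rw [Fintype.card_prod, Fintype.card_bool] at h2
  omega

/-- The flow along matchings bounds the variation of `F` between `Ω₀` and `Ω` by its variation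
along the moves that flip two half-edges. -/
lemma sum_sq_sub_le (hb : IsWinding w b) (hw : ∀ x, 0 ≤ w x) (F : Config E → ℝ) :
    ∑ z : Config E with disagreements z = 0,
      ∑ y : Config E with disagreements y = 0 ∨ disagreements y = 2,
        w z * w y * (F y - F z) ^ 2 ≤
    Fintype.card E * (∑ y : Config E with
        disagreements y = 0 ∨ disagreements y = 2 ∨ disagreements y = 4, w y) *
      ∑ a : Config E with disagreements a = 0 ∨ disagreements a = 2,
        ∑ c : Config E with (disagreements c = 0 ∨ disagreements c = 2) ∧ hammingDist a c = 2,
          min (w a) (w c) * (F c - F a) ^ 2 := by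
  have hpre : ∀ M : Finset (Finset (E × Bool)),
      ∃ pre : Finset (E × Bool) → Finset (Finset (E × Bool)),
      IsMatching M → (splitEdges (support M)).card ≤ 2 →
      (∀ S ∈ M, pre S ⊆ M ∧ S ∉ pre S ∧ (splitEdges (support (pre S))).card ≤ 2 ∧
        (splitEdges (support (insert S (pre S)))).card ≤ 2) ∧
      ∀ g : Finset (Finset (E × Bool)) → ℝ,
        ∑ S ∈ M, (g (insert S (pre S)) - g (pre S)) = g M - g ∅ := by
    intro M
    by_cases h : IsMatching M ∧ (splitEdges (support M)).card ≤ 2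
    · obtain ⟨pre, hp⟩ := h.1.exists_winding_order M h.2
      exact ⟨pre, fun _ _ => hp⟩
    · exact ⟨fun _ => ∅, fun h1 h2 => absurd ⟨h1, h2⟩ h⟩
  choose pre hpre using hpre
  set Mm := (matchings (E × Bool)).filter fun M => (splitEdges (support M)).card ≤ 2 with hMm
  set Z := ∑ y : Config E with
        disagreements y = 0 ∨ disagreements y = 2 ∨ disagreements y = 4, w y with hZ
  have hsmall : ∀ N : Finset (Finset (E × Bool)), IsMatching N →
      (splitEdges (support N)).card ≤ 4 → (splitEdges (support N)).card = 0 ∨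
        (splitEdges (support N)).card = 2 ∨ (splitEdges (support N)).card = 4 := by
    intro N hN h
    obtain ⟨r, hr⟩ := (even_card_splitEdges _).2 hN.even_card_support
    omega
  calc _ = ∑ z : Config E with disagreements z = 0, ∑ M ∈ Mm,
        b z M * (F (flip z (support M)) - F z) ^ 2 := by
        refine sum_congr rfl fun z hz => ?_
        have hz := (mem_filter.1 hz).2
        rw [hb.sum_mul_eq z (fun y => disagreements y = 0 ∨ disagreements y = 2)
          (fun y hy => even_card_diff hz (by rcases hy with h | h <;> rw [h] <;> decide))
          (fun y => (F y - F z) ^ 2)]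
        refine sum_congr (filter_congr fun M hM => ?_) fun _ _ => rfl
        rw [disagreements_flip hz]
        have := hsmall M (mem_matchings.1 hM)
        omega
    -- Telescoping along the path and Cauchy–Schwarz; the factor is the maximal number of moves,
    -- since the blocks are disjoint pairs among 2|E| half-edges.
    _ ≤ ∑ z : Config E with disagreements z = 0, ∑ M ∈ Mm, ∑ S ∈ M,
        Fintype.card E * (b (flip z (support (pre M S))) M *
          (F (flip (flip z (support (pre M S))) S) - F (flip z (support (pre M S)))) ^ 2) := by
        refine sum_le_sum fun z _ => sum_le_sum fun M hM => ?_
        obtain ⟨hM1, hM2⟩ := mem_filter.1 hM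
        rw [mem_matchings] at hM1
        obtain ⟨h1, h2⟩ := hpre M hM1 hM2
        have h3 := h2 fun N => F (flip z (support N))
        simp only [support_empty, flip_empty] at h3
        have h4 : ∑ S ∈ M, Fintype.card E * (b (flip z (support (pre M S))) M *
            (F (flip (flip z (support (pre M S))) S) - F (flip z (support (pre M S)))) ^ 2) =
            b z M * (Fintype.card E * ∑ S ∈ M, (F (flip z (support (insert S (pre M S)))) -
              F (flip z (support (pre M S)))) ^ 2) := by
          rw [mul_sum, mul_sum]
          refine sum_congr rfl fun S hS => ?_
          obtain ⟨h5, h6, -⟩ := h1 S hS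
          rw [hb.flip_support hM1 z h5, flip_flip, hM1.support_insert h5 hS h6]
          ring
        rw [h4, ← h3]
        refine mul_le_mul_of_nonneg_left (sq_sum_le_card_mul_sum_sq.trans ?_) (hb.nonneg z M)
        exact mul_le_mul_of_nonneg_right (by exact_mod_cast card_le_of_isMatching hM1)
          (sum_nonneg fun _ _ => sq_nonneg _)
    _ = Fintype.card E * ∑ M ∈ Mm, ∑ S ∈ M, ∑ z : Config E with disagreements z = 0,
        (b (flip z (support (pre M S))) M *
          (F (flip (flip z (support (pre M S))) S) - F (flip z (support (pre M S)))) ^ 2) := by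
        rw [sum_comm, mul_sum]
        refine sum_congr rfl fun M _ => ?_
        rw [sum_comm, mul_sum]
        refine sum_congr rfl fun S _ => ?_
        rw [mul_sum]
    _ ≤ Fintype.card E * ∑ M ∈ Mm, ∑ S ∈ M,
        ∑ a : Config E with (disagreements a = 0 ∨ disagreements a = 2) ∧
          (disagreements (flip a S) = 0 ∨ disagreements (flip a S) = 2) ∧
          (disagreements (flip a (support M)) = 0 ∨ disagreements (flip a (support M)) = 2 ∨
            disagreements (flip a (support M)) = 4) ∧
          (disagreements (flip (flip a S) (support M)) = 0 ∨
            disagreements (flip (flip a S) (support M)) = 2 ∨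
            disagreements (flip (flip a S) (support M)) = 4),
        b a M * (F (flip a S) - F a) ^ 2 := by
        refine mul_le_mul_of_nonneg_left (sum_le_sum fun M hM => sum_le_sum fun S hS => ?_)
          (Nat.cast_nonneg _)
        refine sum_flip_le (g := fun a => b a M * (F (flip a S) - F a) ^ 2) _ (fun z hz => ?_)
          fun x => mul_nonneg (hb.nonneg x M) (sq_nonneg _)
        have hz := (mem_filter.1 hz).2
        obtain ⟨hM1, hM2⟩ := mem_filter.1 hM
        rw [mem_matchings] at hM1
        obtain ⟨h5, h6, h7, h8⟩ := (hpre M hM1 hM2).1 S hS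
        have hins : insert S (pre M S) ⊆ M := insert_subset hS h5
        have e1 := hsmall _ (hM1.subset h5) (by omega)
        have e2 := hsmall _ (hM1.subset hins) (by omega)
        -- `M` and the initial segment each have at most two split edges, so the complementary
        -- segment has at most four. This is where Z₄ enters.
        have c3 := card_splitEdges_symmDiff_le (support M) (support (pre M S))
        have c4 := card_splitEdges_symmDiff_le (support M) (support (insert S (pre M S)))
        rw [← hM1.support_sdiff h5] at c3
        rw [← hM1.support_sdiff hins] at c4
        have e3 := hsmall (M \ pre M S) (hM1.subset sdiff_subset) (by omega)
        have e4 := hsmall (M \ insert S (pre M S)) (hM1.subset sdiff_subset) (by omega)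
        refine mem_filter.2 ⟨mem_univ _, ?_⟩
        rw [flip_flip z (support (pre M S)) S, ← hM1.support_insert h5 hS h6, flip_flip, flip_flip,
          symmDiff_comm, ← hM1.support_sdiff h5, symmDiff_comm, ← hM1.support_sdiff hins,
          disagreements_flip hz, disagreements_flip hz, disagreements_flip hz,
          disagreements_flip hz]
        omega
    _ ≤ _ := by
        rw [mul_assoc]
        exact mul_le_mul_of_nonneg_left (hb.sum_blocks_le hw
          (fun σ => disagreements σ = 0 ∨ disagreements σ = 2)
          (fun σ => disagreements σ = 0 ∨ disagreements σ = 2 ∨ disagreements σ = 4) F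
          (filter_subset _ _)) (Nat.cast_nonneg _)

end IsWinding

/-! ### Reversible chains: from a Poincaré inequality to mixing -/

/-- `Q` has row sums `1` and satisfies detailed balance with respect to `μ`. -/
structure IsReversible {α : Type*} [Fintype α] (μ : α → ℝ) (Q : Matrix α α ℝ) : Prop where
  row_sum : ∀ a, ∑ b, Q a b = 1
  balance : ∀ a b, μ a * Q a b = μ b * Q b a

namespace IsReversible

variable {α : Type*} [Fintype α] {μ : α → ℝ} {Q K : Matrix α α ℝ}

lemma vecMul_eq (hQ : IsReversible μ Q) : μ ᵥ* Q = μ := by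
  funext b
  simp only [Matrix.vecMul, dotProduct]
  rw [sum_congr rfl fun a _ => hQ.balance a b, ← mul_sum, hQ.row_sum, mul_one]

lemma sum_mulVec_mul (hQ : IsReversible μ Q) (u v : α → ℝ) :
    ∑ a, μ a * ((Q *ᵥ u) a * v a) = ∑ a, μ a * (u a * (Q *ᵥ v) a) := by
  simp only [Matrix.mulVec, dotProduct, sum_mul, mul_sum]
  rw [sum_comm]
  refine sum_congr rfl fun b _ => sum_congr rfl fun a _ => ?_
  linear_combination u b * v a * hQ.balance a b

lemma sum_mulVec (hQ : IsReversible μ Q) (u : α → ℝ) :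
    ∑ a, μ a * (Q *ᵥ u) a = ∑ a, μ a * u a := by
  have h := hQ.sum_mulVec_mul u fun _ => 1
  have h1 : ∀ a, (Q *ᵥ fun _ => (1 : ℝ)) a = 1 := fun a => by
    simp [Matrix.mulVec, dotProduct, hQ.row_sum]
  simpa [h1] using h

lemma sum_sum_left (hQ : IsReversible μ Q) (g : α → ℝ) :
    ∑ a, ∑ b, μ a * Q a b * g a = ∑ a, μ a * g a := by
  refine sum_congr rfl fun a _ => ?_
  rw [← sum_mul, ← mul_sum, hQ.row_sum, mul_one]

lemma sum_sum_right (hQ : IsReversible μ Q) (g : α → ℝ) :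
    ∑ a, ∑ b, μ a * Q a b * g b = ∑ a, μ a * g a := by
  rw [← hQ.sum_sum_left, sum_comm]
  refine sum_congr rfl fun b _ => sum_congr rfl fun a _ => ?_
  rw [hQ.balance]

lemma sum_sum_mul (u v : α → ℝ) :
    ∑ a, ∑ b, μ a * Q a b * (u a * v b) = ∑ a, μ a * (u a * (Q *ᵥ v) a) := by
  simp only [Matrix.mulVec, dotProduct, mul_sum]
  exact sum_congr rfl fun a _ => sum_congr rfl fun b _ => by ring

lemma sum_sum_add_mul_add (hQ : IsReversible μ Q) (u v : α → ℝ) :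
    ∑ a, ∑ b, μ a * Q a b * ((u a + u b) * (v a + v b)) =
      2 * ∑ a, μ a * (u a * v a) + 2 * ∑ a, μ a * (u a * (Q *ᵥ v) a) := by
  have h : ∀ a b, μ a * Q a b * ((u a + u b) * (v a + v b)) =
      μ a * Q a b * (u a * v a) + μ a * Q a b * (u b * v b) + μ a * Q a b * (u a * v b) +
        μ a * Q a b * (v a * u b) := fun a b => by ring
  simp only [h, sum_add_distrib]
  rw [hQ.sum_sum_left fun a => u a * v a, hQ.sum_sum_right fun a => u a * v a, sum_sum_mul,
    sum_sum_mul, ← hQ.sum_mulVec_mul u v]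
  simp only [mul_comm (v _)]
  ring

lemma sum_sum_sub_sq (hQ : IsReversible μ Q) (f : α → ℝ) :
    (1 / 2) * ∑ a, ∑ b, μ a * Q a b * (f b - f a) ^ 2 =
      ∑ a, μ a * (f a * f a) - ∑ a, μ a * (f a * (Q *ᵥ f) a) := by
  have h : ∀ a b, μ a * Q a b * (f b - f a) ^ 2 =
      μ a * Q a b * (f a * f a) + μ a * Q a b * (f b * f b) - 2 * (μ a * Q a b * (f a * f b)) :=
    fun a b => by ring
  simp only [h, sum_add_distrib, sum_sub_distrib, ← mul_sum]
  rw [hQ.sum_sum_left fun a => f a * f a, hQ.sum_sum_right fun a => f a * f a, sum_sum_mul]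
  ring

variable [DecidableEq α]

lemma lazy (hQ : IsReversible μ Q) (hK : K = (1 / 2 : ℝ) • (1 + Q)) : IsReversible μ K := by
  subst hK
  constructor
  · intro a
    simp only [Matrix.smul_apply, Matrix.add_apply, smul_eq_mul, ← mul_sum, sum_add_distrib,
      hQ.row_sum, Matrix.one_apply]
    simp
    norm_num
  · intro a b
    have := hQ.balance a b
    by_cases h : a = b
    · rw [h]
    · simp only [Matrix.smul_apply, Matrix.add_apply, smul_eq_mul, Matrix.one_apply, h, Ne.symm h,
        if_false]
      linarith

lemma pow (hQ : IsReversible μ Q) (t : ℕ) : IsReversible μ (Q ^ t) := by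
  induction t with
  | zero =>
    refine ⟨fun a => by simp [Matrix.one_apply], fun a b => ?_⟩
    by_cases h : a = b
    · rw [h]
    · simp [h, Ne.symm h]
  | succ t ih =>
    constructor
    · intro a
      simp only [pow_succ, Matrix.mul_apply]
      rw [sum_comm]
      simp only [← mul_sum, hQ.row_sum, mul_one, ih.row_sum]
    · intro a b
      rw [pow_succ, Matrix.mul_apply, ← pow_succ, pow_succ', Matrix.mul_apply, mul_sum, mul_sum]
      refine sum_congr rfl fun c _ => ?_
      linear_combination Q c b * ih.balance a c + (Q ^ t) c a * hQ.balance c b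

/-- The form ⟨u, Kv⟩ is a nonnegative combination of the products (u a + u b)(v a + v b), hence
positive semidefinite, and Cauchy–Schwarz applies. -/
lemma sum_lazy_sq_le (hQ : IsReversible μ Q) (hμ : ∀ a, 0 ≤ μ a) (hQ0 : ∀ a b, 0 ≤ Q a b)
    (hK : K = (1 / 2 : ℝ) • (1 + Q)) (u v : α → ℝ) :
    (∑ a, μ a * (u a * (K *ᵥ v) a)) ^ 2 ≤
      (∑ a, μ a * (u a * (K *ᵥ u) a)) * ∑ a, μ a * (v a * (K *ᵥ v) a) := by
  have key : ∀ u v : α → ℝ, ∑ a, μ a * (u a * (K *ᵥ v) a) =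
      (1 / 4) * ∑ p : α × α, μ p.1 * Q p.1 p.2 * ((u p.1 + u p.2) * (v p.1 + v p.2)) := by
    intro u v
    rw [Fintype.sum_prod_type, hQ.sum_sum_add_mul_add, hK, mul_add, ← mul_assoc, ← mul_assoc,
      mul_sum, mul_sum, ← sum_add_distrib]
    refine sum_congr rfl fun a _ => ?_
    simp only [Matrix.smul_mulVec, Matrix.add_mulVec, Matrix.one_mulVec, Pi.smul_apply,
      Pi.add_apply, smul_eq_mul]
    ring
  have hcs := sum_sq_le_sum_mul_sum_of_sq_le_mul (univ : Finset (α × α))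
    (r := fun p => μ p.1 * Q p.1 p.2 * ((u p.1 + u p.2) * (v p.1 + v p.2)))
    (f := fun p => μ p.1 * Q p.1 p.2 * ((u p.1 + u p.2) * (u p.1 + u p.2)))
    (g := fun p => μ p.1 * Q p.1 p.2 * ((v p.1 + v p.2) * (v p.1 + v p.2)))
    (fun p _ => mul_nonneg (mul_nonneg (hμ _) (hQ0 _ _)) (mul_self_nonneg _))
    (fun p _ => mul_nonneg (mul_nonneg (hμ _) (hQ0 _ _)) (mul_self_nonneg _))
    (fun p _ => le_of_eq (by ring))
  rw [key, key, key]
  linarith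

/-- A Poincaré inequality for a lazy reversible chain gives contraction in `L²`. -/
lemma sum_mulVec_sq_le (hQ : IsReversible μ Q) (hμ : ∀ a, 0 ≤ μ a) (hQ0 : ∀ a b, 0 ≤ Q a b)
    (hK : K = (1 / 2 : ℝ) • (1 + Q)) {γ : ℝ} (hγ : γ ≤ 1)
    (hgap : ∀ f : α → ℝ, ∑ a, μ a * f a = 0 →
      γ * ∑ a, μ a * (f a * f a) ≤ (1 / 2) * ∑ a, ∑ b, μ a * K a b * (f b - f a) ^ 2)
    (f : α → ℝ) (hf : ∑ a, μ a * f a = 0) :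
    ∑ a, μ a * ((K *ᵥ f) a * (K *ᵥ f) a) ≤ (1 - γ) ^ 2 * ∑ a, μ a * (f a * f a) := by
  have hKr := hQ.lazy hK
  have hsq : ∀ g : α → ℝ, 0 ≤ ∑ a, μ a * (g a * g a) := fun g =>
    sum_nonneg fun a _ => mul_nonneg (hμ a) (mul_self_nonneg _)
  have hc : ∀ g : α → ℝ, ∑ a, μ a * g a = 0 →
      ∑ a, μ a * (g a * (K *ᵥ g) a) ≤ (1 - γ) * ∑ a, μ a * (g a * g a) := by
    intro g hg
    have h1 := hgap g hg
    rw [hKr.sum_sum_sub_sq] at h1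
    linarith
  have hKf : ∑ a, μ a * (K *ᵥ f) a = 0 := (hKr.sum_mulVec f).trans hf
  -- This gives ‖Kf‖⁴ ≤ ⟨f, Kf⟩⟨Kf, K²f⟩. The gap bounds both factors, and ‖Kf‖² is then cancelled;
  -- no spectral decomposition is needed.
  have hcs := hQ.sum_lazy_sq_le hμ hQ0 hK f (K *ᵥ f)
  rw [← hKr.sum_mulVec_mul] at hcs
  have h1 := hc f hf
  have h2 := hc _ hKf
  have hA := hsq f
  have hN := hsq (K *ᵥ f)
  have h0 : 0 ≤ ∑ a, μ a * (f a * (K *ᵥ f) a) := by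
    have h3 := hQ.sum_sum_add_mul_add f f
    have h4 : ∑ a, μ a * (f a * (K *ᵥ f) a) =
        (1 / 2) * (∑ a, μ a * (f a * f a) + ∑ a, μ a * (f a * (Q *ᵥ f) a)) := by
      rw [hK, ← sum_add_distrib, mul_sum]
      refine sum_congr rfl fun a _ => ?_
      simp only [Matrix.smul_mulVec, Matrix.add_mulVec, Matrix.one_mulVec, Pi.smul_apply,
        Pi.add_apply, smul_eq_mul]
      ring
    have h5 : 0 ≤ ∑ a, ∑ b, μ a * Q a b * ((f a + f b) * (f a + f b)) :=
      sum_nonneg fun a _ => sum_nonneg fun b _ =>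
        mul_nonneg (mul_nonneg (hμ _) (hQ0 _ _)) (mul_self_nonneg _)
    rw [h4]
    linarith
  set N := ∑ a, μ a * ((K *ᵥ f) a * (K *ᵥ f) a)
  set A := ∑ a, μ a * (f a * f a)
  rcases hN.eq_or_lt with h | h
  · rw [← h]
    exact mul_nonneg (sq_nonneg _) hA
  · have h3 : N * N ≤ ((1 - γ) ^ 2 * A) * N := by
      calc N * N = N ^ 2 := by ring
        _ ≤ _ := hcs
        _ ≤ (∑ a, μ a * (f a * (K *ᵥ f) a)) * ((1 - γ) * N) := mul_le_mul_of_nonneg_left h2 h0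
        _ ≤ ((1 - γ) * A) * ((1 - γ) * N) :=
          mul_le_mul_of_nonneg_right h1 (mul_nonneg (by linarith) hN)
        _ = _ := by ring
    exact le_of_mul_le_mul_right h3 h

/-- Mixing of a lazy reversible chain that satisfies a Poincaré inequality. -/
theorem tvDist_pow_le (hQ : IsReversible μ Q) (hμ : ∀ a, 0 ≤ μ a) (hμ1 : ∑ a, μ a = 1)
    (hQ0 : ∀ a b, 0 ≤ Q a b) (hK : K = (1 / 2 : ℝ) • (1 + Q)) {γ : ℝ} (hγ : γ ≤ 1)
    (hgap : ∀ f : α → ℝ, ∑ a, μ a * f a = 0 →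
      γ * ∑ a, μ a * (f a * f a) ≤ (1 / 2) * ∑ a, ∑ b, μ a * K a b * (f b - f a) ^ 2)
    {σ : α} (hσ : 0 < μ σ) (t : ℕ) :
    tvDist ((K ^ t) σ) μ ≤ (1 / 2) * μ σ ^ (-(1 / 2) : ℝ) * Real.exp (-(t * γ)) := by
  have hKr := hQ.lazy hK
  -- The density of the point mass at `σ` relative to `μ`, minus 1; its variance is 1/μ(σ) - 1.
  set f : α → ℝ := fun b => (if b = σ then (μ σ)⁻¹ else 0) - 1 with hf
  have hmean : ∑ a, μ a * f a = 0 := by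
    simp [hf, mul_sub, hμ1, hσ.ne']
  have hvar : ∑ a, μ a * (f a * f a) ≤ (μ σ)⁻¹ := by
    have h : ∀ a, μ a * (f a * f a) =
        (if a = σ then (μ σ)⁻¹ else 0) - 2 * (if a = σ then 1 else 0) + μ a := by
      intro a
      simp only [hf]
      split_ifs with h
      · subst h; field_simp; ring
      · ring
    simp only [h, sum_add_distrib, sum_sub_distrib, ← mul_sum, sum_ite_eq', mem_univ, if_true, hμ1]
    linarith
  have hiter : ∀ t : ℕ, ∑ a, μ a * ((K ^ t) *ᵥ f) a = 0 ∧
      ∑ a, μ a * (((K ^ t) *ᵥ f) a * ((K ^ t) *ᵥ f) a) ≤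
        ((1 - γ) ^ t) ^ 2 * ∑ a, μ a * (f a * f a) := by
    intro t
    induction t with
    | zero => simpa using hmean
    | succ t ih =>
      rw [pow_succ', ← Matrix.mulVec_mulVec]
      refine ⟨(hKr.sum_mulVec _).trans ih.1, ?_⟩
      refine (hQ.sum_mulVec_sq_le hμ hQ0 hK hγ hgap _ ih.1).trans ?_
      calc _ ≤ (1 - γ) ^ 2 * (((1 - γ) ^ t) ^ 2 * ∑ a, μ a * (f a * f a)) :=
            mul_le_mul_of_nonneg_left ih.2 (sq_nonneg _)
        _ = _ := by ring
  -- By reversibility, the density of the law at time `t` evolves by `K` itself.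
  have hval : ∀ a, (K ^ t) σ a - μ a = μ a * ((K ^ t) *ᵥ f) a := by
    intro a
    have h1 : ((K ^ t) *ᵥ f) a = (K ^ t) a σ * (μ σ)⁻¹ - 1 := by
      simp only [Matrix.mulVec, dotProduct, hf, mul_sub, sum_sub_distrib, mul_one,
        (hKr.pow t).row_sum]
      simp
    have h2 := (hKr.pow t).balance a σ
    rw [h1, mul_sub, ← mul_assoc, h2]
    field_simp
  have hcs := sum_sq_le_sum_mul_sum_of_sq_le_mul (univ : Finset α)
    (r := fun a => μ a * |((K ^ t) *ᵥ f) a|) (f := μ)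
    (g := fun a => μ a * (((K ^ t) *ᵥ f) a * ((K ^ t) *ᵥ f) a))
    (fun a _ => hμ a) (fun a _ => mul_nonneg (hμ a) (mul_self_nonneg _))
    (fun a _ => le_of_eq (by rw [mul_pow, sq_abs]; ring))
  rw [hμ1, one_mul] at hcs
  have hsum : ∑ a, |(K ^ t) σ a - μ a| = ∑ a, μ a * |((K ^ t) *ᵥ f) a| :=
    sum_congr rfl fun a _ => by rw [hval, abs_mul, abs_of_nonneg (hμ a)]
  have hexp : (1 - γ) ^ t ≤ Real.exp (-(t * γ)) := by
    calc (1 - γ) ^ t ≤ (Real.exp (-γ)) ^ t :=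
          pow_le_pow_left₀ (by linarith) (Real.one_sub_le_exp_neg γ) t
      _ = _ := by rw [← Real.exp_nat_mul]; ring_nf
  have hpow : (μ σ ^ (-(1 / 2) : ℝ)) ^ 2 = (μ σ)⁻¹ := by
    rw [← Real.rpow_natCast, ← Real.rpow_mul hσ.le, ← Real.rpow_neg_one]
    norm_num
  have hpos : 0 ≤ μ σ ^ (-(1 / 2) : ℝ) := Real.rpow_nonneg hσ.le _
  rw [tvDist, hsum, mul_assoc]
  refine mul_le_mul_of_nonneg_left ?_ (by norm_num)
  have hc0 : 0 ≤ (1 - γ) ^ t := pow_nonneg (by linarith) t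
  refine le_trans (abs_le_of_sq_le_sq' (b := μ σ ^ (-(1 / 2) : ℝ) * (1 - γ) ^ t) ?_
    (mul_nonneg hpos hc0)).2 (mul_le_mul_of_nonneg_left hexp hpos)
  refine (hcs.trans (hiter t).2).trans ?_
  rw [mul_pow, hpow, mul_comm]
  exact mul_le_mul_of_nonneg_right hvar (sq_nonneg _)

end IsReversible

/-! ### The Metropolis chain of a Holant instance -/

namespace Instance

variable {V E : Type*} [Fintype V] (Λ : Instance V E)

lemma weight_nonneg (σ : Config E) : 0 ≤ Λ.weight σ :=
  prod_nonneg fun v _ => Λ.f_nonneg v _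

lemma weight_mul_min (σ π : Config E) :
    Λ.weight σ * min 1 (Λ.weight π / Λ.weight σ) = min (Λ.weight σ) (Λ.weight π) := by
  rcases (Λ.weight_nonneg σ).eq_or_lt with h | h
  · rw [← h, zero_mul, min_eq_left (Λ.weight_nonneg π)]
  · rw [mul_min_of_nonneg _ _ h.le, mul_one, mul_div_cancel₀ _ h.ne']

variable [Fintype E] [DecidableEq E]

lemma Z_nonneg (k : ℕ) : 0 ≤ Λ.Z k := sum_nonneg fun σ _ => Λ.weight_nonneg σ

lemma sum_state (g : Config E → ℝ) :
    ∑ σ : State E, g σ.1 = ∑ σ : Config E with disagreements σ = 0 ∨ disagreements σ = 2, g σ :=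
  (sum_subtype _ (by simp) g).symm

lemma sum_weight : ∑ σ : State E, Λ.weight σ.1 = Λ.Z 0 + Λ.Z 2 := by
  rw [sum_state, filter_or, sum_union]
  · rfl
  · rw [disjoint_filter]
    intro σ _ h
    omega

lemma μ_nonneg (σ : State E) : 0 ≤ Λ.μ σ :=
  div_nonneg (Λ.weight_nonneg _) (add_nonneg (Λ.Z_nonneg 0) (Λ.Z_nonneg 2))

lemma μΩ₀_eq : Λ.μΩ₀ = Λ.Z 0 / (Λ.Z 0 + Λ.Z 2) := by
  simp only [μΩ₀, μ, ← sum_div]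
  congr 1
  rw [sum_filter, sum_state (fun σ => if disagreements σ = 0 then Λ.weight σ else 0), ← sum_filter,
    filter_filter, Z]
  refine sum_congr (filter_congr fun σ _ => ?_) fun _ _ => rfl
  tauto

lemma card_hammingDist_eq_two_le (σ : State E) :
    2 * (univ.filter fun ρ : State E => hammingDist σ.1 ρ.1 = 2).card ≤ numHalfEdges E ^ 2 := by
  have h : (univ.filter fun ρ : State E => hammingDist σ.1 ρ.1 = 2).card ≤
      (powersetCard 2 (univ : Finset (E × Bool))).card := by
    refine card_le_card_of_injOn (fun ρ => diff σ.1 ρ.1) (fun ρ hρ => ?_) fun ρ _ ρ' _ h => ?_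
    · exact mem_powersetCard.2 ⟨subset_univ _, (mem_filter.1 hρ).2⟩
    · exact Subtype.ext ((flipEquiv σ.1).symm.injective h)
  rw [card_powersetCard, card_univ, ← numHalfEdges, Nat.choose_two_right] at h
  have h2 := Nat.mul_div_le (numHalfEdges E * (numHalfEdges E - 1)) 2
  have h3 : numHalfEdges E * (numHalfEdges E - 1) ≤ numHalfEdges E ^ 2 := by
    rw [sq]; exact Nat.mul_le_mul_left _ (Nat.sub_le _ _)
  omega

lemma metropolis_nonneg (σ π : State E) : 0 ≤ Λ.metropolis σ π := by
  have hmin : ∀ ρ : State E, 0 ≤ min 1 (Λ.weight ρ.1 / Λ.weight σ.1) := fun ρ =>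
    le_min zero_le_one (div_nonneg (Λ.weight_nonneg _) (Λ.weight_nonneg _))
  unfold metropolis
  split_ifs with h1 h2
  · exact mul_nonneg (by positivity) (hmin π)
  · have h3 : ∑ ρ : State E with hammingDist σ.1 ρ.1 = 2, min 1 (Λ.weight ρ.1 / Λ.weight σ.1) ≤
        (univ.filter fun ρ : State E => hammingDist σ.1 ρ.1 = 2).card := by
      refine (sum_le_card_nsmul _ _ 1 fun ρ _ => min_le_left _ _).trans (by simp)
    have h4 : (2 : ℝ) * (univ.filter fun ρ : State E => hammingDist σ.1 ρ.1 = 2).card ≤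
        (numHalfEdges E : ℝ) ^ 2 := by exact_mod_cast card_hammingDist_eq_two_le σ
    -- There are at most n²/2 neighbours. For n = 0 the quotient is 0 and the bound still holds.
    rw [sub_nonneg, div_mul_eq_mul_div]
    exact div_le_one_of_le₀ (by linarith) (by positivity)
  · exact le_rfl

lemma weight_mul_metropolis {σ π : State E} (h : σ ≠ π) :
    Λ.weight σ.1 * Λ.metropolis σ π = if hammingDist σ.1 π.1 = 2 then
      2 / (numHalfEdges E : ℝ) ^ 2 * min (Λ.weight σ.1) (Λ.weight π.1) else 0 := by
  rw [metropolis, if_neg h, ← Λ.weight_mul_min]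
  split_ifs <;> ring

lemma isReversible_metropolis : IsReversible Λ.μ Λ.metropolis := by
  constructor
  · intro σ
    have h : ∀ π, Λ.metropolis σ π =
        (if hammingDist σ.1 π.1 = 2 then
          2 / (numHalfEdges E : ℝ) ^ 2 * min 1 (Λ.weight π.1 / Λ.weight σ.1) else 0) +
        if σ = π then 1 - 2 / (numHalfEdges E : ℝ) ^ 2 *
          ∑ ρ : State E with hammingDist σ.1 ρ.1 = 2, min 1 (Λ.weight ρ.1 / Λ.weight σ.1)
          else 0 := by
      intro π
      unfold metropolis
      split_ifs with h1 h2
      · rw [h2, hammingDist_self] at h1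
        omega
      all_goals ring
    simp only [h, sum_add_distrib, sum_ite_eq, mem_univ, if_true]
    rw [← sum_filter, ← mul_sum]
    ring
  · intro σ π
    by_cases h : σ = π
    · rw [h]
    · rw [μ, μ, div_mul_eq_mul_div, div_mul_eq_mul_div, Λ.weight_mul_metropolis h,
        Λ.weight_mul_metropolis (Ne.symm h), hammingDist_comm, min_comm]

lemma lazyChain_eq : Λ.lazyChain = (1 / 2 : ℝ) • (1 + Λ.metropolis) := by
  ext σ π
  simp only [lazyChain, Matrix.smul_apply, Matrix.add_apply, Matrix.one_apply, smul_eq_mul]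
  split_ifs <;> ring

lemma lazyChain_nonneg (σ π : State E) : 0 ≤ Λ.lazyChain σ π := by
  have := Λ.metropolis_nonneg σ π
  unfold lazyChain
  split_ifs <;> linarith

/-- The constant is 1/2 from the form, 1/2 from laziness and 2/n² from the proposal. -/
lemma dirichlet_form_eq (f : State E → ℝ) :
    (1 / 2) * ∑ a, ∑ c, Λ.μ a * Λ.lazyChain a c * (f c - f a) ^ 2 =
      (∑ a : State E, ∑ c : State E, if hammingDist a.1 c.1 = 2 then
        min (Λ.weight a.1) (Λ.weight c.1) * (f c - f a) ^ 2 else 0) /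
        (2 * (numHalfEdges E : ℝ) ^ 2 * (Λ.Z 0 + Λ.Z 2)) := by
  rw [mul_sum, sum_div]
  refine sum_congr rfl fun a _ => ?_
  rw [mul_sum, sum_div]
  refine sum_congr rfl fun c _ => ?_
  by_cases h : a = c
  · subst h; simp
  · have h1 := Λ.weight_mul_metropolis h
    rw [μ, lazyChain, if_neg h]
    have h2 : 1 / 2 * (Λ.weight a.1 / (Λ.Z 0 + Λ.Z 2) * (Λ.metropolis a c / 2) * (f c - f a) ^ 2) =
        Λ.weight a.1 * Λ.metropolis a c * (f c - f a) ^ 2 / (4 * (Λ.Z 0 + Λ.Z 2)) := by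
      field_simp
      ring
    rw [h2, h1]
    split_ifs
    · field_simp
      ring
    · simp

/-! ### The Poincaré inequality and the mixing bound -/

variable [DecidableEq V] {Λ}

/-- The Poincaré inequality for the winding chain, in terms of the weights. -/
lemma Z_sq_mul_sum_le (hΛ : ∀ v, Windable (Λ.f v)) (f : State E → ℝ)
    (hf : ∑ σ : State E, Λ.weight σ.1 * f σ = 0) :
    Λ.Z 0 ^ 2 * ∑ σ : State E, Λ.weight σ.1 * (f σ * f σ) ≤
      Fintype.card E * (Λ.Z 0 + Λ.Z 2) ^ 2 *
        ∑ a : State E, ∑ c : State E, if hammingDist a.1 c.1 = 2 then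
          min (Λ.weight a.1) (Λ.weight c.1) * (f c - f a) ^ 2 else 0 := by
  obtain ⟨b, hb⟩ := exists_isWinding Λ.endpoint Λ.f hΛ
  change IsWinding Λ.weight b at hb
  set F : Config E → ℝ := fun σ =>
    if h : disagreements σ = 0 ∨ disagreements σ = 2 then f ⟨σ, h⟩ else 0 with hF
  have hFf : ∀ σ : State E, F σ.1 = f σ := fun σ => by simp only [hF, dif_pos σ.2]
  have hflow := hb.sum_sq_sub_le Λ.weight_nonneg F
  have h04 := hb.sum_zero_mul_sum_four_le Λ.weight_nonneg
  have hZ4 : ∑ y : Config E with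
      disagreements y = 0 ∨ disagreements y = 2 ∨ disagreements y = 4, Λ.weight y =
      Λ.Z 0 + Λ.Z 2 + Λ.Z 4 := by
    rw [filter_or, filter_or, sum_union, sum_union]
    · simp only [Z]; ring
    all_goals
      simp only [disjoint_union_right, disjoint_filter]
      grind
  have henergy : ∑ a : Config E with disagreements a = 0 ∨ disagreements a = 2,
      ∑ c : Config E with (disagreements c = 0 ∨ disagreements c = 2) ∧ hammingDist a c = 2,
        min (Λ.weight a) (Λ.weight c) * (F c - F a) ^ 2 =
      ∑ a : State E, ∑ c : State E, if hammingDist a.1 c.1 = 2 then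
          min (Λ.weight a.1) (Λ.weight c.1) * (f c - f a) ^ 2 else 0 := by
    rw [← sum_state]
    refine sum_congr rfl fun a _ => ?_
    rw [← filter_filter, sum_filter, ← sum_state]
    simp only [hFf]
  -- For centred `f`, the mean square distance to any fixed value F(z) is at least the variance, so
  -- starting points in Ω₀ suffice.
  have hlow : Λ.Z 0 * ∑ σ : State E, Λ.weight σ.1 * (f σ * f σ) ≤
      ∑ z : Config E with disagreements z = 0,
        ∑ y : Config E with disagreements y = 0 ∨ disagreements y = 2,
          Λ.weight z * Λ.weight y * (F y - F z) ^ 2 := by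
    rw [Z, sum_mul]
    refine sum_le_sum fun z _ => ?_
    rw [← sum_state]
    have h1 : ∑ y : State E, Λ.weight z * Λ.weight y.1 * (F y.1 - F z) ^ 2 =
        Λ.weight z * ∑ σ : State E, Λ.weight σ.1 * (f σ * f σ) -
          2 * Λ.weight z * F z * ∑ σ : State E, Λ.weight σ.1 * f σ +
          Λ.weight z * F z ^ 2 * ∑ σ : State E, Λ.weight σ.1 := by
      rw [mul_sum, mul_sum, mul_sum, ← sum_sub_distrib, ← sum_add_distrib]
      refine sum_congr rfl fun y _ => ?_
      rw [hFf]
      ring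
    rw [h1, hf, mul_zero, sub_zero]
    have h2 : 0 ≤ ∑ σ : State E, Λ.weight σ.1 := sum_nonneg fun σ _ => Λ.weight_nonneg _
    have h3 := mul_nonneg (mul_nonneg (Λ.weight_nonneg z) (sq_nonneg (F z))) h2
    linarith
  rw [hZ4, henergy] at hflow
  set D := ∑ a : State E, ∑ c : State E, if hammingDist a.1 c.1 = 2 then
          min (Λ.weight a.1) (Λ.weight c.1) * (f c - f a) ^ 2 else 0
  have hD : 0 ≤ D := by
    refine sum_nonneg fun a _ => sum_nonneg fun c _ => ?_
    split_ifs
    · exact mul_nonneg (le_min (Λ.weight_nonneg _) (Λ.weight_nonneg _)) (sq_nonneg _)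
    · exact le_rfl
  have hz : Λ.Z 0 * (Λ.Z 0 + Λ.Z 2 + Λ.Z 4) ≤ (Λ.Z 0 + Λ.Z 2) ^ 2 := by
    have h1 : Λ.Z 0 * Λ.Z 4 ≤ Λ.Z 2 ^ 2 := h04
    have h2 := mul_nonneg (Λ.Z_nonneg 0) (Λ.Z_nonneg 2)
    linarith
  calc Λ.Z 0 ^ 2 * ∑ σ : State E, Λ.weight σ.1 * (f σ * f σ)
      = Λ.Z 0 * (Λ.Z 0 * ∑ σ : State E, Λ.weight σ.1 * (f σ * f σ)) := by ring
    _ ≤ Λ.Z 0 * (Fintype.card E * (Λ.Z 0 + Λ.Z 2 + Λ.Z 4) * D) :=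
      mul_le_mul_of_nonneg_left (hlow.trans hflow) (Λ.Z_nonneg 0)
    _ = (Λ.Z 0 * (Λ.Z 0 + Λ.Z 2 + Λ.Z 4)) * (Fintype.card E * D) := by ring
    _ ≤ (Λ.Z 0 + Λ.Z 2) ^ 2 * (Fintype.card E * D) :=
      mul_le_mul_of_nonneg_right hz (mul_nonneg (Nat.cast_nonneg _) hD)
    _ = _ := by ring

lemma poincare (hΛ : ∀ v, Windable (Λ.f v)) (hZ : 0 < Λ.Z 0 + Λ.Z 2) (f : State E → ℝ)
    (hf : ∑ σ, Λ.μ σ * f σ = 0) :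
    Λ.μΩ₀ ^ 2 / (numHalfEdges E : ℝ) ^ 4 * ∑ σ, Λ.μ σ * (f σ * f σ) ≤
      (1 / 2) * ∑ a, ∑ c, Λ.μ a * Λ.lazyChain a c * (f c - f a) ^ 2 := by
  have hμ : ∀ g : State E → ℝ, ∑ σ, Λ.μ σ * g σ =
      (∑ σ : State E, Λ.weight σ.1 * g σ) / (Λ.Z 0 + Λ.Z 2) := by
    intro g
    rw [sum_div]
    exact sum_congr rfl fun σ _ => by rw [μ, div_mul_eq_mul_div]
  have hf' : ∑ σ : State E, Λ.weight σ.1 * f σ = 0 := by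
    rw [hμ, div_eq_zero_iff] at hf
    exact hf.resolve_right hZ.ne'
  have h := Z_sq_mul_sum_le hΛ f hf'
  rw [Λ.dirichlet_form_eq, hμ, Λ.μΩ₀_eq]
  have hD : 0 ≤ ∑ a : State E, ∑ c : State E, if hammingDist a.1 c.1 = 2 then
          min (Λ.weight a.1) (Λ.weight c.1) * (f c - f a) ^ 2 else 0 := by
    refine sum_nonneg fun a _ => sum_nonneg fun c _ => ?_
    split_ifs
    · exact mul_nonneg (le_min (Λ.weight_nonneg _) (Λ.weight_nonneg _)) (sq_nonneg _)
    · exact le_rfl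
  set D := ∑ a : State E, ∑ c : State E, if hammingDist a.1 c.1 = 2 then
          min (Λ.weight a.1) (Λ.weight c.1) * (f c - f a) ^ 2 else 0
  set A := ∑ σ : State E, Λ.weight σ.1 * (f σ * f σ)
  set Z := Λ.Z 0 + Λ.Z 2
  have hn : (numHalfEdges E : ℝ) = 2 * Fintype.card E := by
    rw [numHalfEdges, Fintype.card_prod, Fintype.card_bool]
    push_cast; ring
  rcases Nat.eq_zero_or_pos (Fintype.card E) with h0 | h0
  · rw [hn, h0]; simp
  have hm : (1 : ℝ) ≤ Fintype.card E := by exact_mod_cast h0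
  rw [hn]
  set m : ℝ := (Fintype.card E : ℝ)
  have hm0 : 0 < m := by linarith
  have e1 : (Λ.Z 0 / Z) ^ 2 / (2 * m) ^ 4 * (A / Z) = Λ.Z 0 ^ 2 * A / (16 * m ^ 4 * Z ^ 3) := by
    field_simp
    ring
  have e2 : D / (2 * (2 * m) ^ 2 * Z) = (2 * m * (m * Z ^ 2 * D)) / (16 * m ^ 4 * Z ^ 3) := by
    field_simp
    ring
  rw [e1, e2]
  refine div_le_div_of_nonneg_right (h.trans ?_) (by positivity)
  have h3 : 0 ≤ m * Z ^ 2 * D := by positivity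
  -- The flow bound is better than needed by the factor 2m = n ≥ 1.
  nlinarith

end Instance

end Holant

theorem mainTheorem1 {V E : Type*} [Fintype V] [DecidableEq V] [Fintype E] [DecidableEq E]
    (Λ : Holant.Instance V E) (hΛ : ∀ v, Holant.Windable (Λ.f v)) :
    ((∀ σ π, 0 ≤ Λ.lazyChain σ π) ∧ (∀ σ, ∑ π, Λ.lazyChain σ π = 1) ∧
      Λ.μ ᵥ* Λ.lazyChain = Λ.μ) ∧
    ∀ σ : Holant.State E, 0 < Λ.weight σ.1 → ∀ t : ℕ,
      Holant.tvDist ((Λ.lazyChain ^ t) σ) Λ.μ ≤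
        (1 / 2) * Λ.μ σ ^ (-(1 / 2) : ℝ) *
          Real.exp (-(t * Λ.μΩ₀ ^ 2 / (Holant.numHalfEdges E : ℝ) ^ 4)) := by
  have hrev := Λ.isReversible_metropolis.lazy Λ.lazyChain_eq
  refine ⟨⟨Λ.lazyChain_nonneg, hrev.row_sum, hrev.vecMul_eq⟩, fun σ hσ t => ?_⟩
  have hZ : 0 < Λ.Z 0 + Λ.Z 2 := by
    rw [← Λ.sum_weight]
    exact Finset.sum_pos' (fun π _ => Λ.weight_nonneg π.1) ⟨σ, Finset.mem_univ σ, hσ⟩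
  have hμ1 : ∑ π, Λ.μ π = 1 := by
    simp only [Holant.Instance.μ, ← Finset.sum_div, Λ.sum_weight, div_self hZ.ne']
  have hγ : Λ.μΩ₀ ^ 2 / (Holant.numHalfEdges E : ℝ) ^ 4 ≤ 1 := by
    have h0 : 0 ≤ Λ.μΩ₀ := Finset.sum_nonneg fun π _ => Λ.μ_nonneg π
    have h1 : Λ.μΩ₀ ≤ 1 := by
      rw [Λ.μΩ₀_eq]
      exact div_le_one_of_le₀ (by linarith [Λ.Z_nonneg 2]) hZ.le
    -- For n = 0 the rate is a division by zero, hence 0, and the exponential is 1.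
    rcases Nat.eq_zero_or_pos (Holant.numHalfEdges E) with hn | hn
    · rw [hn]; simp
    · have hn1 : (1 : ℝ) ≤ Holant.numHalfEdges E := by exact_mod_cast hn
      exact div_le_one_of_le₀ ((pow_le_one₀ h0 h1).trans (one_le_pow₀ hn1)) (by positivity)
  have h := Λ.isReversible_metropolis.tvDist_pow_le Λ.μ_nonneg hμ1 Λ.metropolis_nonneg
    Λ.lazyChain_eq hγ (Holant.Instance.poincare hΛ hZ) (div_pos hσ hZ) t
  rwa [← mul_div_assoc] at h
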